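/- All trees are finite rooted trees. For a rooted tree $\mathcal T$, $\mathrm{Aut}(\mathcal T)$ is the group of automorphisms fixing the root, $\mathrm{Ch}(u)$ is the set of children of $u$, a vertex is internal if it has a child and a leaf otherwise, and $\mathcal T_u$ is the subtree formed by $u$ and its descendants. A rooted tree homomorphism sends the root to the root, children of $u$ to children of the image of $u$, and leaves to leaves; $\varphi_u\colon\mathcal T_u\to\mathcal P_{\varphi(u)}$ denotes the restriction of $\varphi\colon\mathcal T\to\mathcal P$. A *$\mathcal P$-composition* of $\mathcal T$ (an element of $\mathsf C(\mathcal T,\mathcal P)$) is a surjective rooted tree homomorphism $\varphi\colon\mathcal T\to\mathcal P$ such that, for all distinct internal siblings $u,v$ with $\varphi(u)=\varphi(v)$, there is $\tau\in\mathrm{Aut}(\mathcal T)$ with $\tau(u)=v$ and $\varphi_u=\varphi_v\circ\tau|_{\mathcal T_u}$. The group $\mathrm{Aut}(\mathcal T)$ acts on $\mathsf C(\mathcal T,\mathcal P)$ by $g\varphi=\varphi\circ g^{-1}$, and $K_\varphi$ is the stabilizer of $\varphi$. Maps $f_i\colon\mathcal T_i\to\mathcal P_i$ ($i=1,2$) are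 *equivalent* if $\omega\circ f_1=f_2\circ\tau$ for rooted tree isomorphisms $\tau\colon\mathcal T_1\to\mathcal T_2$, $\omega\colon\mathcal P_1\to\mathcal P_2$, and *strictly equivalent* if moreover $\mathcal P_1=\mathcal P_2$ and $\omega=\mathrm{id}$. The *quotient* of $\varphi\in\mathsf C(\mathcal T,\mathcal P)$ is the composition $\alpha\in\mathsf C(\mathcal P,\mathcal Q)$, unique up to isomorphisms of $\mathcal Q$, such that: (i) for every $x\in\mathcal P$, all the leaves in $\mathrm{Ch}(x)$ are sent by $\alpha$ to the unique leaf in $\mathrm{Ch}(\alpha(x))$; (ii) if $a\neq b$ are internal siblings of $\mathcal Q$ and $u,v$ are siblings of $\mathcal T$ with $\alpha(\varphi(u))=a$, $\alpha(\varphi(v))=b$, then $\varphi_u,\varphi_v$ are not equivalent; (iii) if $u,w\in\mathcal T$ are internal and $\alpha(\varphi(u))=\alpha(\varphi(w))$, then $\varphi_u,\varphi_w$ are equivalent and $(\alpha\circ\varphi)_u,(\alpha\circ\varphi)_w$ are strictly equivalent. The *tree of partitions* $(\Lambda,\mathcal Q)$ of $\varphi$ assigns to each non-root $b\in\mathcal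 Q$ the integer partition $\lambda^b$ whose parts are the numbers $|\varphi^{-1}(y)\cap\mathrm{Ch}(u)|$, $y\in\mathrm{Ch}(\varphi(u))\cap\alpha^{-1}(b)$, where $u$ is any vertex such that $\alpha(\varphi(u))$ is the parent of $b$. A *transpose* of $\varphi$ is a composition $\varphi^t\in\mathsf C(\mathcal T,\mathcal P^t)$ with a quotient $\alpha^t\in\mathsf C(\mathcal P^t,\mathcal Q)$ such that $\alpha^t\circ\varphi^t=\alpha\circ\varphi$, the tree of partitions of $\varphi^t$ is $b\mapsto(\lambda^b)^t$ (conjugate partitions), and $|\varphi^{-1}(x)\cap(\varphi^t)^{-1}(y)|\le1$ for all internal $v\in\mathcal T$, $x\in\mathrm{Ch}(\varphi(v))$, $y\in\mathrm{Ch}(\varphi^t(v))$. The homomorphism $\mathrm{sign}\colon\mathrm{Aut}(\mathcal T)\to\{\pm1\}$ is defined recursively by $$\mathrm{sign}(g)=\mathrm{sign}(g|_{V})\prod_{c}\prod_{v\in c}\mathrm{sign}\bigl(\tau_{u_c,g(v)}\circ g|_{\mathcal T_v}\circ\tau_{u_c,v}^{-1}\bigr),$$ where $V$ is the set of children of the root,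 $\mathrm{sign}(g|_V)$ is the usual sign of a permutation, $c$ runs over the classes of internal vertices $v\in V$ under isomorphism of the subtrees $\mathcal T_v$, $u_c\in c$ is a chosen element, and $\tau_{u_c,v}\colon\mathcal T_v\to\mathcal T_{u_c}$ ($v\in c$) are chosen isomorphisms with $\tau_{u_c,u_c}=\mathrm{id}$ (the result does not depend on the choices). **Statement.** Let $\varphi\in\mathsf C(\mathcal T,\mathcal P)$ and let $\varphi^t\in\mathsf C(\mathcal T,\mathcal P^t)$ be a transpose of $\varphi$. Then the complex representations $$M^{|\varphi^{-1}|}=\mathrm{Ind}_{K_\varphi}^{\mathrm{Aut}(\mathcal T)}\iota\qquad\text{and}\qquad\widetilde M^{|(\varphi^t)^{-1}|}=\mathrm{Ind}_{K_{\varphi^t}}^{\mathrm{Aut}(\mathcal T)}\mathrm{sign}$$ ($\iota$ the trivial representation) have, up to isomorphism, exactly one common irreducible constituent, and it occurs with multiplicity one in each of them. -/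

import Mathlib

universe u v

noncomputable section

namespace TreeRep

/-! A finite rooted tree is a finite `RootedTree` of Mathlib, whose order is `ancestor ≤ descendant`.
The root is `⊥`, `u ⋖ v` says that `v` is a child of `u`, a leaf is a maximal element.
Rooted tree isomorphisms are order isomorphisms; in particular `Aut(T)` is the group `T ≃o T`. -/

/-- The subtree `T_u`, made up of `u` and of all its descendants. -/
abbrev below (T : RootedTree.{u}) (u : T) : RootedTree.{u} := (T.subtree u).coeTree

/-- A vertex with at least one child. -/
def Internal {T : RootedTree.{u}} (u : T) : Prop := ∃ v, u ⋖ v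

/-- A vertex without children. -/
def Leaf {T : RootedTree.{u}} (u : T) : Prop := ¬ Internal u

/-- `u` and `v` have the same parent. -/
def Siblings {T : RootedTree.{u}} (u v : T) : Prop := ∃ p, p ⋖ u ∧ p ⋖ v

/-! ### Tree compositions -/

/-- Tree compositions of `T` indexed by `P`, that is the set `C(T, P)`. Rooted tree homomorphisms
send the root to the root, children to children (so that `T_u` is mapped into `P_{φ(u)}`) and leaves
to leaves. -/
@[ext]
structure TreeComposition (T P : RootedTree.{u}) where
  toFun : T → P
  map_root : toFun ⊥ = ⊥
  map_child : ∀ ⦃u v : T⦄, u ⋖ v → toFun u ⋖ toFun v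
  map_leaf : ∀ ⦃u : T⦄, Leaf u → Leaf (toFun u)
  surjective : Function.Surjective toFun
  /-- The regularity condition: `φ_u = φ_v ∘ τ_u` for some automorphism `τ` with `τ(u) = v`. -/
  regular : ∀ ⦃u v : T⦄, u ≠ v → Siblings u v → Internal u → Internal v → toFun u = toFun v →
    ∃ τ : T ≃o T, τ u = v ∧ ∀ x, u ≤ x → toFun x = toFun (τ x)

namespace TreeComposition

variable {T P Q : RootedTree.{u}}

instance : CoeFun (TreeComposition T P) (fun _ => T → P) := ⟨TreeComposition.toFun⟩

theorem monotone (φ : TreeComposition T P) : Monotone φ := by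
  intro a b hab
  obtain ⟨n, hn⟩ := hab.exists_pred_iterate
  induction n generalizing a with
  | zero => exact le_of_eq (by rw [← hn]; rfl)
  | succ n ih =>
    rw [Function.iterate_succ_apply'] at hn
    have h1 : φ (Order.pred^[n] b) ≤ φ b := ih (Order.pred_iterate_le n b) rfl
    by_cases hm : IsMin (Order.pred^[n] b)
    · rw [hm.pred_eq] at hn
      rwa [← hn]
    · have hc := Order.pred_covBy_of_not_isMin hm
      rw [hn] at hc
      exact (φ.map_child hc).le.trans h1

/-- The restriction `φ_u : T_u → P_{φ(u)}`. -/
def restrict (φ : TreeComposition T P) (u : T) : below T u → below P (φ u) :=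
  fun x => ⟨φ x.1, φ.monotone x.2⟩

end TreeComposition

/-- Equivalence of two maps of rooted trees: `ω ∘ f₁ = f₂ ∘ τ` for isomorphisms `τ`, `ω`. -/
def AreEquivalent {T₁ P₁ T₂ P₂ : RootedTree.{u}} (f₁ : T₁ → P₁) (f₂ : T₂ → P₂) : Prop :=
  ∃ (τ : T₁ ≃o T₂) (ω : P₁ ≃o P₂), ∀ x, ω (f₁ x) = f₂ (τ x)

/-- Strict equivalence of two maps of rooted trees with values in the same tree. -/
def AreStrictlyEquivalent {T₁ T₂ P : RootedTree.{u}} (f₁ : T₁ → P) (f₂ : T₂ → P) : Prop :=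
  ∃ τ : T₁ ≃o T₂, ∀ x, f₁ x = f₂ (τ x)

/-- `α` is the quotient of `φ` (it exists and is unique up to isomorphisms of its codomain). -/
structure IsQuotient {T P Q : RootedTree.{u}} (φ : TreeComposition T P)
    (α : TreeComposition P Q) : Prop where
  /-- All the leaves among the children of `x` are sent to one vertex, the unique child of `α x`
  which is a leaf. -/
  leaves : ∀ (x y : P) (b : Q), x ⋖ y → Leaf y → α x ⋖ b → Leaf b → b = α y
  not_equivalent : ∀ (a b : Q), a ≠ b → Siblings a b → Internal a → Internal b →
    ∀ u v : T, Siblings u v → α (φ u) = a → α (φ v) = b →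
      ¬ AreEquivalent (φ.restrict u) (φ.restrict v)
  equivalent : ∀ u w : T, Internal u → Internal w → α (φ u) = α (φ w) →
    AreEquivalent (φ.restrict u) (φ.restrict w)
  strictly_equivalent : ∀ u w : T, Internal u → Internal w → α (φ u) = α (φ w) →
    AreStrictlyEquivalent (T₁ := below T u) (T₂ := below T w)
      (fun x => α (φ x.1)) (fun x => α (φ x.1))

/-! ### The tree of partitions and the transpose -/

/-- The integer partition, as a Young diagram, whose parts are the elements of a multiset. -/
def diagram (m : Multiset ℕ) : YoungDiagram :=
  YoungDiagram.ofRowLens (m.sort (· ≥ ·)) (Multiset.pairwise_sort m (· ≥ ·)).sortedGE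

/-- The sizes of the blocks `φ⁻¹(y) ∩ Ch(u)`, where `y` runs over `Ch(φ(u)) ∩ α⁻¹(b)`. -/
def blockSizes {T P Q : RootedTree.{u}} [Finite T] (φ : TreeComposition T P)
    (α : TreeComposition P Q) (u : T) (b : Q) : Multiset ℕ :=
  haveI : Finite P := Finite.of_surjective φ φ.surjective
  (Set.toFinite {y : P | φ u ⋖ y ∧ α y = b}).toFinset.val.map
    fun y => {v : T | u ⋖ v ∧ φ v = y}.ncard

/-- A partitional labeling of `Q`: an integer partition for every vertex different from the root. -/
abbrev PartitionalLabeling (Q : RootedTree.{u}) := {b : Q // b ≠ ⊥} → YoungDiagram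

/-- Replace every partition of a labeling by its conjugate. -/
def PartitionalLabeling.transpose {Q : RootedTree.{u}} (Λ : PartitionalLabeling Q) :
    PartitionalLabeling Q := fun b => (Λ b).transpose

/-- `Λ` is the tree of partitions associated to `φ`, with quotient `α`: for every child `b` of
`α(φ(u))`, the partition `λ^b` is the type of the set partition of `(α ∘ φ)⁻¹(b) ∩ Ch(u)` into the
fibers of `φ`. -/
def IsTreeOfPartitions {T P Q : RootedTree.{u}} [Finite T] (φ : TreeComposition T P)
    (α : TreeComposition P Q) (Λ : PartitionalLabeling Q) : Prop :=
  ∀ (u : T) (b : Q) (h : α (φ u) ⋖ b), Λ ⟨b, h.lt.ne_bot⟩ = diagram (blockSizes φ α u b)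

/-- `φ` and `ψ` have `0-1` intersection. -/
def ZeroOneIntersection {T P M : RootedTree.{u}} (φ : TreeComposition T P)
    (ψ : TreeComposition T M) : Prop :=
  ∀ v : T, Internal v → ∀ (x : P) (y : M), φ v ⋖ x → ψ v ⋖ y →
    {t : T | φ t = x ∧ ψ t = y}.encard ≤ 1

/-- `φt` is a transpose of `φ`. -/
def IsTranspose {T P P' : RootedTree.{u}} [Finite T] (φ : TreeComposition T P)
    (φt : TreeComposition T P') : Prop :=
  (∃ (Q : RootedTree.{u}) (α : TreeComposition P Q) (αt : TreeComposition P' Q)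
    (Λ : PartitionalLabeling Q),
      IsQuotient φ α ∧ IsQuotient φt αt ∧ (∀ u, αt (φt u) = α (φ u)) ∧
      IsTreeOfPartitions φ α Λ ∧ IsTreeOfPartitions φt αt Λ.transpose) ∧
  ZeroOneIntersection φ φt

/-! ### The action of `Aut(T)` and the stabilizers -/

theorem internal_map {T₁ T₂ : RootedTree.{u}} (g : T₁ ≃o T₂) {x : T₁} (h : Internal x) :
    Internal (g x) := by
  obtain ⟨v, hv⟩ := h
  exact ⟨g v, (apply_covBy_apply_iff g).2 hv⟩

theorem internal_map_iff {T₁ T₂ : RootedTree.{u}} (g : T₁ ≃o T₂) {x : T₁} :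
    Internal (g x) ↔ Internal x :=
  ⟨fun h => by simpa using internal_map g.symm h, internal_map g⟩

/-- `Aut(T)` acts on `C(T, P)` by `g φ = φ ∘ g⁻¹`. -/
instance {T P : RootedTree.{u}} : MulAction (T ≃o T) (TreeComposition T P) where
  smul g φ :=
    { toFun := fun x => φ (g⁻¹ x)
      map_root := by
        have : g⁻¹ ⊥ = ⊥ := OrderIso.map_bot _
        rw [this, φ.map_root]
      map_child := fun u v h => φ.map_child ((apply_covBy_apply_iff g⁻¹).2 h)
      map_leaf := fun u h => φ.map_leaf (fun h' => h ((internal_map_iff g⁻¹).1 h'))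
      surjective := φ.surjective.comp (OrderIso.surjective g⁻¹)
      regular := by
        intro u v huv hs hu hv he
        obtain ⟨p, hpu, hpv⟩ := hs
        obtain ⟨τ, hτ, hτ'⟩ := φ.regular (u := g⁻¹ u) (v := g⁻¹ v)
          (fun h => huv ((OrderIso.injective g⁻¹) h))
          ⟨g⁻¹ p, (apply_covBy_apply_iff g⁻¹).2 hpu, (apply_covBy_apply_iff g⁻¹).2 hpv⟩
          (internal_map _ hu) (internal_map _ hv) he
        refine ⟨g * τ * g⁻¹, ?_, fun x hx => ?_⟩
        · simp only [RelIso.mul_apply, hτ, RelIso.apply_inv_self]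
        · have := hτ' (g⁻¹ x) ((OrderIso.le_iff_le g⁻¹).2 hx)
          simpa only [RelIso.mul_apply, RelIso.inv_apply_self] using this }
  one_smul φ := rfl
  mul_smul g h φ := by
    apply TreeComposition.ext
    funext x
    change φ ((g * h)⁻¹ x) = φ (h⁻¹ (g⁻¹ x))
    rw [mul_inv_rev, RelIso.mul_apply]

/-- The stabilizer `K_φ` of `φ` in `Aut(T)`. -/
def stab {T P : RootedTree.{u}} (φ : TreeComposition T P) : Subgroup (T ≃o T) :=
  MulAction.stabilizer (T ≃o T) φ

/-! ### The sign representation of `Aut(T)` -/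

section Sign

open Classical

attribute [local instance] Fintype.ofFinite

/-- The first level `V_T`. -/
abbrev FirstLevel (T : RootedTree.{u}) := {v : T // ⊥ ⋖ v}

/-- The internal vertices of the first level, `V_T ∖ W_T`. -/
abbrev InternalFirstLevel (T : RootedTree.{u}) := {v : T // ⊥ ⋖ v ∧ Internal v}

/-- The permutation of the first level induced by an automorphism. -/
def firstLevelPerm (T : RootedTree.{u}) : (T ≃o T) →* Equiv.Perm (FirstLevel T) where
  toFun g := g.toEquiv.subtypeEquiv fun v => by
    have h := apply_covBy_apply_iff g (a := ⊥) (b := v)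
    rw [OrderIso.map_bot] at h
    exact h.symm
  map_one' := rfl
  map_mul' _ _ := rfl

/-- The permutation of the internal vertices of the first level induced by an automorphism. -/
def internalPerm (T : RootedTree.{u}) : (T ≃o T) →* Equiv.Perm (InternalFirstLevel T) where
  toFun g := g.toEquiv.subtypeEquiv fun v => by
    have h := apply_covBy_apply_iff g (a := ⊥) (b := v)
    rw [OrderIso.map_bot] at h
    exact and_congr h.symm (internal_map_iff g).symm
  map_one' := rfl
  map_mul' _ _ := rfl

/-- The restriction `g_v : T_v → T_{g(v)}`. -/
def restrictAut {T : RootedTree.{u}} (g : T ≃o T) (v : T) : below T v ≃o below T (g v) where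
  toEquiv := g.toEquiv.subtypeEquiv fun x => (OrderIso.le_iff_le g (x := v) (y := x)).symm
  map_rel_iff' := fun {a b} => OrderIso.le_iff_le g (x := a.1) (y := b.1)

/-- First level internal vertices `v`, `w` with `T_v` and `T_w` isomorphic: these are the fibers of
the trivial composition on `V_T ∖ W_T`. -/
def isoSetoid (T : RootedTree.{u}) : Setoid (InternalFirstLevel T) where
  r v w := Nonempty (below T v.1 ≃o below T w.1)
  iseqv := ⟨fun _ => ⟨OrderIso.refl _⟩, fun ⟨e⟩ => ⟨e.symm⟩, fun ⟨e⟩ ⟨f⟩ => ⟨e.trans f⟩⟩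

/-- The internal vertices `c` of the first level of the codomain of the trivial composition. -/
abbrev FirstLevelClass (T : RootedTree.{u}) := Quotient (isoSetoid T)

/-- The chosen vertex `u_c` in the class `c`. -/
def rep {T : RootedTree.{u}} (c : FirstLevelClass T) : InternalFirstLevel T := c.out

/-- The class `c`, as a set of vertices. -/
abbrev Fiber {T : RootedTree.{u}} (c : FirstLevelClass T) :=
  {v : InternalFirstLevel T // Quotient.mk (isoSetoid T) v = c}

/-- The vertex `u_c` as an element of the class `c`. -/
def repFiber {T : RootedTree.{u}} (c : FirstLevelClass T) : Fiber c := ⟨rep c, Quotient.out_eq c⟩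

/-- An auxiliary choice of isomorphisms. -/
def chosenIso {T : RootedTree.{u}} {c : FirstLevelClass T} (v : Fiber c) :
    below T v.1.1 ≃o below T (rep c).1 :=
  Classical.choice (Quotient.exact (v.2.trans (Quotient.out_eq c).symm))

/-- The isomorphisms `τ_{u_c, v} : T_v → T_{u_c}`, normalized by `τ_{u_c, u_c} = id`; the other ones
are `τ_{v, u_c} = τ_{u_c, v}⁻¹` and `τ_{w, v} = τ_{w, u_c} ∘ τ_{u_c, v}`. -/
def tau {T : RootedTree.{u}} {c : FirstLevelClass T} (v : Fiber c) :
    below T v.1.1 ≃o below T (rep c).1 :=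
  (chosenIso v).trans (chosenIso (repFiber c)).symm

theorem mk_internalPerm {T : RootedTree.{u}} (g : T ≃o T) (v : InternalFirstLevel T) :
    Quotient.mk (isoSetoid T) (internalPerm T g v) = Quotient.mk (isoSetoid T) v :=
  Quotient.sound ⟨(restrictAut g v.1).symm⟩

/-- The permutation of the class `c` induced by an automorphism. -/
def fiberPerm {T : RootedTree.{u}} (c : FirstLevelClass T) (g : T ≃o T) : Equiv.Perm (Fiber c) :=
  (internalPerm T g).subtypeEquiv fun v => by rw [mk_internalPerm]

/-- The automorphism `τ_{u_c, g(v)} ∘ g_v ∘ τ_{v, u_c}` of `T_{u_c}`. -/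
def localAut {T : RootedTree.{u}} {c : FirstLevelClass T} (g : T ≃o T) (v : Fiber c) :
    below T (rep c).1 ≃o below T (rep c).1 :=
  ((tau v).symm.trans (restrictAut g v.1.1)).trans (tau (fiberPerm c g v))

theorem localAut_one {T : RootedTree.{u}} {c : FirstLevelClass T} (v : Fiber c) :
    localAut (1 : T ≃o T) v = 1 := by
  apply OrderIso.ext
  funext x
  exact (tau v).apply_symm_apply x

theorem localAut_mul {T : RootedTree.{u}} {c : FirstLevelClass T} (g h : T ≃o T) (v : Fiber c) :
    localAut (g * h) v = localAut g (fiberPerm c h v) * localAut h v := by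
  apply OrderIso.ext
  funext x
  have h1 := (tau (fiberPerm c h v)).symm_apply_apply (restrictAut h v.1.1 ((tau v).symm x))
  exact (congrArg (fun y => tau (fiberPerm c g (fiberPerm c h v))
    (restrictAut g (fiberPerm c h v).1.1 y)) h1).symm

theorem card_below_lt {T : RootedTree.{u}} [Finite T] {v : T} (hv : ⊥ ⋖ v) :
    Nat.card (below T v) < Nat.card T :=
  Finite.card_subtype_lt (x := ⊥) (p := fun x => v ≤ x) (not_le_of_gt hv.lt)

/-- The recursive formula for the sign: given characters `s c` of the groups `Aut(T_{u_c})`, the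
value at `g` is the sign of the permutation of the first level induced by `g`, times the product,
over `c` and over the vertices `v` of the class `c`, of the values of `s c` at
`τ_{u_c, g(v)} ∘ g_v ∘ τ_{v, u_c} ∈ Aut(T_{u_c})`. -/
def signStep (T : RootedTree.{u}) [Finite T]
    (s : ∀ c : FirstLevelClass T, (below T (rep c).1 ≃o below T (rep c).1) →* ℤˣ) :
    (T ≃o T) →* ℤˣ where
  toFun g := Equiv.Perm.sign (firstLevelPerm T g) *
    ∏ c : FirstLevelClass T, ∏ v : Fiber c, s c (localAut g v)
  map_one' := by
    simp only [localAut_one]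
    simp only [map_one, Finset.prod_const_one, mul_one]
  map_mul' g h := by
    have key : ∀ c : FirstLevelClass T,
        ∏ v : Fiber c, s c (localAut g (fiberPerm c h v)) = ∏ v : Fiber c, s c (localAut g v) :=
      fun c => Equiv.prod_comp (fiberPerm c h) (fun v => s c (localAut g v))
    have key2 : ∀ c : FirstLevelClass T,
        ∏ v : Fiber c, s c (localAut (g * h) v) =
          (∏ v : Fiber c, s c (localAut g v)) * ∏ v : Fiber c, s c (localAut h v) := by
      intro c
      rw [← key c, ← Finset.prod_mul_distrib]
      refine Finset.prod_congr rfl fun v _ => ?_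
      rw [localAut_mul, map_mul]
    simp only [key2, Finset.prod_mul_distrib, map_mul]
    exact mul_mul_mul_comm _ _ _ _

instance {T : RootedTree.{u}} [Finite T] (v : T) : Finite (below T v) :=
  inferInstanceAs (Finite (Set.Ici v))

/-- The sign representation of `Aut(T)`, by recursion on the first level subtrees. -/
def treeSign (T : RootedTree.{u}) [Finite T] : (T ≃o T) →* ℤˣ :=
  signStep T fun c => treeSign (below T (rep c).1)
termination_by Nat.card T
decreasing_by exact card_below_lt (rep c).2.1

end Sign

/-! ### Representations -/

/-- The one-dimensional complex representation given by a character with values `±1`. -/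
def charRep {G : Type u} [Group G] (χ : G →* ℤˣ) : Representation ℂ G ℂ where
  toFun g := ((χ g : ℤ) : ℂ) • LinearMap.id
  map_one' := by ext; simp
  map_mul' g h := by ext; simp [mul_comm]

/-- `M^{|φ⁻¹|}`, the representation of `Aut(T)` induced by the trivial representation of `K_φ`. -/
abbrev youngModule {T P : RootedTree.{u}} (φ : TreeComposition T P) :=
  Representation.ind (stab φ).subtype (Representation.trivial ℂ (stab φ) ℂ)

/-- The representation of `Aut(T)` induced by the sign representation, restricted to `K_φ`. -/
abbrev signedYoungModule {T P : RootedTree.{u}} [Finite T] (φ : TreeComposition T P) :=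
  Representation.ind (stab φ).subtype (charRep ((treeSign T).comp (stab φ).subtype))

/-- `σ` is isomorphic to a subrepresentation of `ρ`. -/
def IsConstituent {G V W : Type*} [Group G] [AddCommGroup V] [Module ℂ V] [AddCommGroup W]
    [Module ℂ W] (σ : Representation ℂ G V) (ρ : Representation ℂ G W) : Prop :=
  ∃ f : σ.IntertwiningMap ρ, Function.Injective f

/-- The multiplicity of an irreducible representation `σ` in `ρ`: the dimension of
`Hom_G(σ, ρ)`. -/
def constituentMultiplicity {G V W : Type*} [Group G] [AddCommGroup V] [Module ℂ V] [AddCommGroup W]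
    [Module ℂ W] (σ : Representation ℂ G V) (ρ : Representation ℂ G W) : ℕ :=
  Module.finrank ℂ (σ.IntertwiningMap ρ)

end TreeRep

end

noncomputable section

namespace TreeRep

/-! ### Elementary facts on rooted trees -/

/-! Put `G = Aut(T)`, `H = K_φ`, `K = K_ψ` with `ψ = φᵗ`. Everything follows once `Hom_G(Ind_H ι,
Ind_K sign)` is one-dimensional (`finrank_intertwiningMap_ind`): by complete reducibility, the image
of a nonzero map is then the only common constituent, with multiplicity one on both sides
(`exists_common_constituent`).

In the spirit of Mackey, the dimension of this space is the number of double cosets `HgK` such that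
the sign is trivial on `H ∩ gKg⁻¹`. The coset `HK` counts because the `0`-`1` intersection forces `H
∩ K = 1` (`stab_inf_stab_eq_bot`). That no other one counts is `exists_mul_of_treeSign`. Exchanging
two sibling subtrees has sign `-1` (`treeSign_of_isSwap`), so on a coset that counts no such swap
preserves both `φ` and `ψ' = ψ ∘ g⁻¹`. What remains is combinatorial: a map `ψ'` isomorphic to `ψ`
and swap-free with respect to `φ` is carried to `ψ` by an automorphism preserving `φ`
(`transposeUnique`). For trees of height one this is the uniqueness, up to permutations preserving
the rows, of a `0`-`1` matrix with conjugate row and column sums.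

For general trees, uniqueness is proved by induction together with an extremal property replacing
the dominance order (`WeightLe`): if `(θ, ψ)` is a tableau, then `θ` has the largest weight among
the regular maps swap-free with respect to `ψ`, and a map of equal weight has the same fibers as `θ`
up to an automorphism. On one level this rests on an elementary fact: `k` distinct natural numbers
`a` satisfy `∑ (2a + 1) ≥ k²`, with equality only for `0, …, k - 1`. Numbering the columns by `j`
therefore bounds the number of pairs in a common row by `∑ (2j + 1)`, and tableaux attain the bound.
Conjugacy of the partitions enters only through `exists_tableau`, which constructs `j`. -/

theorem parent_unique {T : RootedTree.{u}} {p q x : T} (hp : p ⋖ x) (hq : q ⋖ x) : p = q := by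
  rcases (le_total_of_directed hp.le hq.le).symm with h | h
  · exact (hp.eq_or_eq h hq.le).elim Eq.symm fun h' => absurd h' hq.lt.ne
  · exact (hq.eq_or_eq h hp.le).elim id fun h' => absurd h' hp.lt.ne

theorem le_parent_of_lt {T : RootedTree.{u}} {p x y : T} (hp : p ⋖ x) (hy : y < x) : y ≤ p := by
  rcases (le_total_of_directed hp.le hy.le).symm with h | h
  · exact (hp.eq_or_eq h hy.le).elim le_of_eq fun h' => absurd h' hy.ne
  · exact h

theorem exists_parent {T : RootedTree.{u}} {x : T} (hx : x ≠ ⊥) : ∃ p, p ⋖ x :=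
  ⟨Order.pred x, Order.pred_covBy_of_not_isMin fun h => hx h.eq_bot⟩

theorem parent_induction {T : RootedTree.{u}} {P : T → Prop} (h0 : P ⊥)
    (h : ∀ p x, p ⋖ x → P p → P x) (x : T) : P x := by
  obtain ⟨n, hn⟩ := (bot_le (a := x)).exists_pred_iterate
  induction n generalizing x with
  | zero => exact (show x = ⊥ from hn) ▸ h0
  | succ n ih =>
    by_cases hx : x = ⊥
    · exact hx ▸ h0
    · exact h _ x (Order.pred_covBy_of_not_isMin fun h => hx h.eq_bot) (ih _ hn)

theorem exists_firstLevel_le {T : RootedTree.{u}} {x : T} (hx : x ≠ ⊥) :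
    ∃ v : FirstLevel T, v.1 ≤ x := by
  induction x using parent_induction with
  | h0 => exact absurd rfl hx
  | h p x hp ih =>
    by_cases h : p = ⊥
    · exact ⟨⟨x, h ▸ hp⟩, le_rfl⟩
    · obtain ⟨v, hv⟩ := ih h
      exact ⟨v, hv.trans hp.le⟩

theorem eq_of_siblings_of_le {T : RootedTree.{u}} {u v x : T} (h : Siblings u v) (hu : u ≤ x)
    (hv : v ≤ x) : u = v := by
  obtain ⟨p, hpu, hpv⟩ := h
  rcases (le_total_of_directed hu hv).symm with h | h
  · exact (hpv.eq_or_eq hpu.le h).resolve_left hpu.lt.ne'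
  · exact ((hpu.eq_or_eq hpv.le h).resolve_left hpv.lt.ne').symm

theorem siblings_firstLevel {T : RootedTree.{u}} (u v : FirstLevel T) : Siblings u.1 v.1 :=
  ⟨⊥, u.2, v.2⟩

theorem firstLevel_eq_of_le {T : RootedTree.{u}} {u v : FirstLevel T} {x : T} (hu : u.1 ≤ x)
    (hv : v.1 ≤ x) : u = v :=
  Subtype.ext (eq_of_siblings_of_le (siblings_firstLevel u v) hu hv)

theorem not_le_bot {T : RootedTree.{u}} (u : FirstLevel T) : ¬ u.1 ≤ ⊥ := not_le_of_gt u.2.lt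

/-! ### Embeddings onto subtrees -/

/-- `f` identifies `S` with the set of descendants of the image of the root of `S`. -/
structure SubtreeEmb {S T : RootedTree.{u}} (f : S → T) : Prop where
  le_iff : ∀ a b, f a ≤ f b ↔ a ≤ b
  upper : ∀ a t, f a ≤ t → ∃ b, f b = t

theorem subtreeEmb_orderIso {S T : RootedTree.{u}} (e : S ≃o T) : SubtreeEmb e where
  le_iff _ _ := e.le_iff_le
  upper _ t _ := ⟨e.symm t, e.apply_symm_apply t⟩

theorem subtreeEmb_val {T : RootedTree.{u}} (u : T) :
    SubtreeEmb (S := below T u) (T := T) Subtype.val where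
  le_iff _ _ := Iff.rfl
  upper a t h := ⟨⟨t, le_trans a.2 h⟩, rfl⟩

namespace SubtreeEmb

variable {S T : RootedTree.{u}} {f : S → T}

theorem injective (hf : SubtreeEmb f) : Function.Injective f := fun a b h =>
  le_antisymm ((hf.le_iff a b).1 h.le) ((hf.le_iff b a).1 h.ge)

theorem lt_iff (hf : SubtreeEmb f) (a b : S) : f a < f b ↔ a < b := by
  simp only [lt_iff_le_not_ge, hf.le_iff]

theorem covBy_iff (hf : SubtreeEmb f) (a b : S) : f a ⋖ f b ↔ a ⋖ b := by
  refine ⟨fun h => ⟨(hf.lt_iff a b).1 h.1, fun c hac hcb =>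
    h.2 ((hf.lt_iff a c).2 hac) ((hf.lt_iff c b).2 hcb)⟩, fun h => ⟨(hf.lt_iff a b).2 h.1, ?_⟩⟩
  intro c hac hcb
  obtain ⟨c, rfl⟩ := hf.upper a c hac.le
  exact h.2 ((hf.lt_iff a c).1 hac) ((hf.lt_iff c b).1 hcb)

theorem siblings (hf : SubtreeEmb f) {a b : S} (h : Siblings a b) : Siblings (f a) (f b) := by
  obtain ⟨p, ha, hb⟩ := h
  exact ⟨f p, (hf.covBy_iff _ _).2 ha, (hf.covBy_iff _ _).2 hb⟩

/-- The isomorphism `S_a ≃ T_{f(a)}` induced by `f`. -/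
def belowIso (hf : SubtreeEmb f) (a : S) : below S a ≃o below T (f a) where
  toEquiv := Equiv.ofBijective
    (fun x => (⟨f x.1, (hf.le_iff a x.1).2 x.2⟩ : below T (f a)))
    ⟨fun _ _ h => Subtype.ext (hf.injective (congrArg Subtype.val h)), fun y => by
      obtain ⟨b, hb⟩ := hf.upper a y.1 y.2
      exact ⟨⟨b, (hf.le_iff a b).1 (hb ▸ y.2)⟩, Subtype.ext hb⟩⟩
  map_rel_iff' := fun {x y} => hf.le_iff x.1 y.1

end SubtreeEmb

/-! ### Gluing isomorphisms of the first level subtrees -/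

/-- A vertex other than the root lies above exactly one vertex of the first level, so the pieces
determine one map, and two vertices are comparable only inside one piece or when one of them is the
root. -/
theorem exists_glue {T T' : RootedTree.{u}} (h : FirstLevel T ≃ FirstLevel T')
    (τ : ∀ v : FirstLevel T, below T v.1 ≃o below T' (h v).1) :
    ∃ ε : T ≃o T', ∀ (v : FirstLevel T) (x : below T v.1), ε x.1 = (τ v x).1 := by
  classical
  have hex : ∀ x : T, ∃ y : T', (x = ⊥ → y = ⊥) ∧
      ∀ (v : FirstLevel T) (hv : v.1 ≤ x), y = (τ v ⟨x, hv⟩).1 := by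
    intro x
    by_cases hx : x = ⊥
    · subst hx
      exact ⟨⊥, fun _ => rfl, fun v hv => absurd hv (not_le_bot v)⟩
    · obtain ⟨v, hv⟩ := exists_firstLevel_le hx
      refine ⟨(τ v ⟨x, hv⟩).1, fun h => absurd h hx, fun w hw => ?_⟩
      obtain rfl := firstLevel_eq_of_le hv hw
      rfl
  choose f hf0 hf using hex
  have hle : ∀ a b, f a ≤ f b ↔ a ≤ b := by
    intro a b
    by_cases ha : a = ⊥
    · rw [hf0 a ha, ha]
      exact iff_of_true bot_le bot_le
    obtain ⟨v, hv⟩ := exists_firstLevel_le ha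
    have hva : (h v).1 ≤ f a := hf a v hv ▸ (τ v ⟨a, hv⟩).2
    by_cases hb : b = ⊥
    · refine iff_of_false (fun hab => ?_) fun hab => ?_
      · rw [hf0 b hb] at hab
        exact not_le_bot (h v) (hva.trans hab)
      · rw [hb] at hab
        exact not_le_bot v (hv.trans hab)
    obtain ⟨w, hw⟩ := exists_firstLevel_le hb
    have hwb : (h w).1 ≤ f b := hf b w hw ▸ (τ w ⟨b, hw⟩).2
    by_cases hvw : v = w
    · subst hvw
      rw [hf a v hv, hf b v hw]
      exact (τ v).le_iff_le (x := ⟨a, hv⟩) (y := ⟨b, hw⟩)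
    · refine iff_of_false (fun hab => hvw ?_) fun hab => hvw ?_
      · exact h.injective (firstLevel_eq_of_le (hva.trans hab) hwb)
      · exact firstLevel_eq_of_le (hv.trans hab) hw
  have hsurj : Function.Surjective f := by
    intro y
    by_cases hy : y = ⊥
    · exact ⟨⊥, (hf0 ⊥ rfl).trans hy.symm⟩
    · obtain ⟨w, hw⟩ := exists_firstLevel_le hy
      obtain ⟨v, rfl⟩ := h.surjective w
      refine ⟨((τ v).symm ⟨y, hw⟩).1, ?_⟩
      rw [hf _ v ((τ v).symm ⟨y, hw⟩).2]
      exact congrArg Subtype.val ((τ v).apply_symm_apply ⟨y, hw⟩)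
  exact ⟨RelIso.ofSurjective (OrderEmbedding.ofMapLEIff f hle) hsurj, fun v x => hf x.1 v x.2⟩

/-! ### Regular maps -/

/-- The restriction of a map to the subtree `T_u`. -/
abbrev res {T : RootedTree.{u}} {X : Type*} (φ : T → X) (u : T) : below T u → X := fun x => φ x.1

/-- `φ` and `θ` differ by an isomorphism of their domains. -/
def StrictEquiv {T T' : RootedTree.{u}} {X : Type*} (φ : T → X) (θ : T' → X) : Prop :=
  ∃ τ : T ≃o T', ∀ x, θ (τ x) = φ x

/-- An isomorphism of the domains maps the fibers of `φ` to the fibers of `θ`. -/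
def KerEquiv {T T' : RootedTree.{u}} {X Y : Type*} (φ : T → X) (θ : T' → Y) : Prop :=
  ∃ τ : T ≃o T', ∀ x y, φ x = φ y ↔ θ (τ x) = θ (τ y)

namespace StrictEquiv

variable {T₁ T₂ T₃ : RootedTree.{u}} {X : Type*} {f₁ : T₁ → X} {f₂ : T₂ → X} {f₃ : T₃ → X}

theorem refl (f₁ : T₁ → X) : StrictEquiv f₁ f₁ := ⟨OrderIso.refl _, fun _ => rfl⟩

theorem symm : StrictEquiv f₁ f₂ → StrictEquiv f₂ f₁ := fun ⟨τ, h⟩ =>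
  ⟨τ.symm, fun x => by rw [← h, τ.apply_symm_apply]⟩

theorem trans : StrictEquiv f₁ f₂ → StrictEquiv f₂ f₃ → StrictEquiv f₁ f₃ := fun ⟨τ, h⟩ ⟨σ, k⟩ =>
  ⟨τ.trans σ, fun x => (k _).trans (h x)⟩

theorem kerEquiv : StrictEquiv f₁ f₂ → KerEquiv f₁ f₂ := fun ⟨τ, h⟩ =>
  ⟨τ, fun x y => by rw [h, h]⟩

end StrictEquiv

namespace KerEquiv

variable {T₁ T₂ T₃ : RootedTree.{u}} {X Y Z : Type*} {f₁ : T₁ → X} {f₂ : T₂ → Y} {f₃ : T₃ → Z}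

theorem refl (f₁ : T₁ → X) : KerEquiv f₁ f₁ := ⟨OrderIso.refl _, fun _ _ => Iff.rfl⟩

theorem symm : KerEquiv f₁ f₂ → KerEquiv f₂ f₁ := fun ⟨τ, h⟩ =>
  ⟨τ.symm, fun x y => by rw [h, τ.apply_symm_apply, τ.apply_symm_apply]⟩

theorem trans : KerEquiv f₁ f₂ → KerEquiv f₂ f₃ → KerEquiv f₁ f₃ := fun ⟨τ, h⟩ ⟨σ, k⟩ =>
  ⟨τ.trans σ, fun x y => (h x y).trans (k _ _)⟩

end KerEquiv

theorem SubtreeEmb.strictEquiv {S T : RootedTree.{u}} {f : S → T} (hf : SubtreeEmb f) {X : Type*}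
    (φ : T → X) (a : S) : StrictEquiv (res (fun x => φ (f x)) a) (res φ (f a)) :=
  ⟨hf.belowIso a, fun _ => rfl⟩

/-- The fibers of `φ` are those of a tree composition. -/
structure Regular {T : RootedTree.{u}} {X : Type*} (φ : T → X) : Prop where
  eq_of_le : ∀ x y, x ≤ y → φ x = φ y → x = y
  parent : ∀ p q x y, p ⋖ x → q ⋖ y → φ x = φ y → φ p = φ q
  strict : ∀ u v, Siblings u v → φ u = φ v → StrictEquiv (res φ u) (res φ v)

theorem Regular.comp {S T : RootedTree.{u}} {X : Type*} {φ : T → X} (hφ : Regular φ) {f : S → T}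
    (hf : SubtreeEmb f) : Regular fun x => φ (f x) where
  eq_of_le x y h e := hf.injective (hφ.eq_of_le _ _ ((hf.le_iff x y).2 h) e)
  parent p q x y hp hq e :=
    hφ.parent _ _ _ _ ((hf.covBy_iff p x).2 hp) ((hf.covBy_iff q y).2 hq) e
  strict u v h e := ((hf.strictEquiv φ u).trans (hφ.strict _ _ (hf.siblings h) e)).trans
    (hf.strictEquiv φ v).symm

/-- Equal values pass to parents, so one climbs from `x` and `y` simultaneously. Neither path can
reach the root before the other, because `φ` is injective on chains. -/
theorem Regular.firstLevel_eq {T : RootedTree.{u}} {X : Type*} {φ : T → X} (hφ : Regular φ)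
    {u v : FirstLevel T} (x : T) (y : T) (hx : u.1 ≤ x) (hy : v.1 ≤ y) (h : φ x = φ y) :
    φ u.1 = φ v.1 := by
  induction x using parent_induction generalizing y with
  | h0 => exact absurd hx (not_le_bot u)
  | h p x hp ih =>
    obtain ⟨q, hq⟩ := exists_parent (x := y) fun h' => not_le_bot v (h' ▸ hy)
    have e := hφ.parent _ _ _ _ hp hq h
    have key : ∀ {w : FirstLevel T} {r z : T}, r ⋖ z → w.1 ≤ z → (w.1 = z ∧ r = ⊥) ∨ w.1 ≤ r := by
      intro w r z hr hw
      rcases hw.eq_or_lt with h | h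
      · exact Or.inl ⟨h, parent_unique hr (h ▸ w.2)⟩
      · exact Or.inr (le_parent_of_lt hr h)
    rcases key hp hx with ⟨h1, h2⟩ | h1 <;> rcases key hq hy with ⟨h3, h4⟩ | h3
    · rw [h1, h3, h]
    · have := hφ.eq_of_le p q (h2 ▸ bot_le) e
      exact absurd (h3.trans (this ▸ h2).le) (not_le_bot v)
    · have := hφ.eq_of_le q p (h4 ▸ bot_le) e.symm
      exact absurd (h1.trans (this ▸ h4).le) (not_le_bot u)
    · exact ih q h1 h3 e

/-! ### Swaps -/

/-- No two distinct siblings can be exchanged without changing `φ` and `ψ`. -/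
def SwapFree {T : RootedTree.{u}} {X Z : Type*} (φ : T → X) (ψ : T → Z) : Prop :=
  ∀ u v : T, Siblings u v → u ≠ v →
    ¬ StrictEquiv (res (fun x => (φ x, ψ x)) u) (res (fun x => (φ x, ψ x)) v)

theorem SwapFree.comp {S T : RootedTree.{u}} {X Z : Type*} {φ : T → X} {ψ : T → Z}
    (h : SwapFree φ ψ) {f : S → T} (hf : SubtreeEmb f) :
    SwapFree (fun x => φ (f x)) fun x => ψ (f x) := fun u v huv hne hs =>
  h _ _ (hf.siblings huv) (hf.injective.ne hne)
    (((hf.strictEquiv (fun x => (φ x, ψ x)) u).symm.trans hs).trans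
      (hf.strictEquiv (fun x => (φ x, ψ x)) v))

theorem SwapFree.ne {T : RootedTree.{u}} {X Z : Type*} {φ : T → X} {ψ : T → Z}
    (h : SwapFree φ ψ) {u v : T} (huv : Siblings u v)
    (τ : below T u ≃o below T v) (h1 : ∀ x, φ (τ x).1 = φ x.1) (h2 : ∀ x, ψ (τ x).1 = ψ x.1) :
    u = v :=
  by_contra fun hne => h u v huv hne ⟨τ, fun x => Prod.ext (h1 x) (h2 x)⟩

/-! ### The sign of a swap -/

theorem SubtreeEmb.comp {R S T : RootedTree.{u}} {f : S → T} {g : R → S} (hf : SubtreeEmb f)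
    (hg : SubtreeEmb g) : SubtreeEmb fun x => f (g x) where
  le_iff a b := (hf.le_iff _ _).trans (hg.le_iff a b)
  upper a t h := by
    obtain ⟨b, rfl⟩ := hf.upper _ t h
    obtain ⟨c, rfl⟩ := hg.upper a b ((hf.le_iff _ _).1 h)
    exact ⟨c, rfl⟩

/-- `g` exchanges two subtrees `T_u`, `T_v`, with `u`, `v` siblings, and fixes all the other
vertices. -/
def IsSwap {T : RootedTree.{u}} (g : T ≃o T) : Prop :=
  ∃ u v : T, Siblings u v ∧ u ≠ v ∧ g u = v ∧ (∀ x, g (g x) = x) ∧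
    ∀ x, ¬ u ≤ x → ¬ v ≤ x → g x = x

theorem exists_swap {T : RootedTree.{u}} {u v : T} (huv : Siblings u v) (hne : u ≠ v)
    (τ : below T u ≃o below T v) :
    ∃ g : T ≃o T, IsSwap g ∧ (∀ x : below T u, g x.1 = (τ x).1) ∧
      (∀ y : below T v, g y.1 = (τ.symm y).1) ∧ ∀ x, ¬ u ≤ x → ¬ v ≤ x → g x = x := by
  have hex : ∀ x : T, ∃ y : T, (∀ h : u ≤ x, y = (τ ⟨x, h⟩).1) ∧
      (∀ h : v ≤ x, y = (τ.symm ⟨x, h⟩).1) ∧ (¬ u ≤ x → ¬ v ≤ x → y = x) := by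
    intro x
    by_cases hu : u ≤ x
    · exact ⟨(τ ⟨x, hu⟩).1, fun _ => rfl, fun h => absurd (eq_of_siblings_of_le huv hu h) hne,
        fun h => absurd hu h⟩
    by_cases hv : v ≤ x
    · exact ⟨(τ.symm ⟨x, hv⟩).1, fun h => absurd h hu, fun _ => rfl, fun _ h => absurd hv h⟩
    · exact ⟨x, fun h => absurd h hu, fun h => absurd h hv, fun _ _ => rfl⟩
  choose f hfu hfv hf using hex
  have hu' : ∀ x, u ≤ x → v ≤ f x := fun x h => hfu x h ▸ (τ ⟨x, h⟩).2
  have hv' : ∀ x, v ≤ x → u ≤ f x := fun x h => hfv x h ▸ (τ.symm ⟨x, h⟩).2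
  have hinv : ∀ x, f (f x) = x := by
    intro x
    by_cases hu : u ≤ x
    · rw [hfv _ (hu' x hu)]
      have : (⟨f x, hu' x hu⟩ : below T v) = τ ⟨x, hu⟩ := Subtype.ext (hfu x hu)
      rw [this, τ.symm_apply_apply]
    by_cases hv : v ≤ x
    · rw [hfu _ (hv' x hv)]
      have : (⟨f x, hv' x hv⟩ : below T u) = τ.symm ⟨x, hv⟩ := Subtype.ext (hfv x hv)
      rw [this, τ.apply_symm_apply]
    · rw [hf x hu hv, hf x hu hv]
  have hmono : ∀ a b, a ≤ b → f a ≤ f b := by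
    intro a b hab
    by_cases hu : u ≤ a
    · rw [hfu a hu, hfu b (hu.trans hab)]
      exact τ.monotone (show (⟨a, hu⟩ : below T u) ≤ ⟨b, hu.trans hab⟩ from hab)
    by_cases hv : v ≤ a
    · rw [hfv a hv, hfv b (hv.trans hab)]
      exact τ.symm.monotone (show (⟨a, hv⟩ : below T v) ≤ ⟨b, hv.trans hab⟩ from hab)
    rw [hf a hu hv]
    obtain ⟨p, hpu, hpv⟩ := huv
    -- A vertex outside both subtrees but below a vertex of one of them lies below the common parent
    -- `p`, hence below both subtrees; the exchange keeps the inequality.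
    have hlt : ∀ {w : T}, p ⋖ w → ¬ w ≤ a → w ≤ b → a ≤ p := fun {w} hpw hwa hwb =>
      le_parent_of_lt hpw (((le_total_of_directed hab hwb).resolve_left hwa).lt_of_ne
        fun h => hwa h.ge)
    by_cases hub : u ≤ b
    · exact (hlt hpu hu hub).trans (hpv.le.trans (hu' b hub))
    by_cases hvb : v ≤ b
    · exact (hlt hpv hv hvb).trans (hpu.le.trans (hv' b hvb))
    · rwa [hf b hub hvb]
  let g : T ≃o T :=
    { toFun := f, invFun := f, left_inv := hinv, right_inv := hinv
      map_rel_iff' := fun {a b} => ⟨fun h => by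
        have := hmono _ _ h
        simpa only [Equiv.coe_fn_mk, hinv] using this, hmono a b⟩ }
  refine ⟨g, ⟨u, v, huv, hne, ?_, hinv, hf⟩, fun x => hfu x.1 x.2, fun x => hfv x.1 x.2, hf⟩
  exact (hfu u le_rfl).trans (congrArg Subtype.val (τ.map_bot))

/-- Allows a swap deep in `T` to be read inside `T_{u_c}`, as required by the recursion for the
sign. -/
theorem IsSwap.of_subtreeEmb {S T : RootedTree.{u}} {f : S → T} (hf : SubtreeEmb f) {g' : S ≃o S}
    {g : T ≃o T} (hg : ∀ x, f (g' x) = g (f x)) {p u v : T} (hp : f ⊥ ≤ p) (hu : p ⋖ u)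
    (hv : p ⋖ v) (hne : u ≠ v) (huv : g u = v) (hinv : ∀ x, g (g x) = x)
    (hfix : ∀ x, ¬ u ≤ x → ¬ v ≤ x → g x = x) : IsSwap g' := by
  obtain ⟨p, rfl⟩ := hf.upper _ p hp
  obtain ⟨u, rfl⟩ := hf.upper _ u hu.le
  obtain ⟨v, rfl⟩ := hf.upper _ v hv.le
  refine ⟨u, v, ⟨p, (hf.covBy_iff _ _).1 hu, (hf.covBy_iff _ _).1 hv⟩, fun h => hne (h ▸ rfl),
    hf.injective (by rw [hg, huv]), fun x => hf.injective (by rw [hg, hg, hinv]),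
    fun x h1 h2 => hf.injective ?_⟩
  rw [hg, hfix _ (fun h => h1 ((hf.le_iff _ _).1 h)) fun h => h2 ((hf.le_iff _ _).1 h)]

theorem internal_of_lt {T : RootedTree.{u}} {a x : T} (h : a < x) : Internal a := by
  induction x using parent_induction with
  | h0 => exact absurd h not_lt_bot
  | h p x hp ih =>
    rcases (le_parent_of_lt hp h).eq_or_lt with rfl | h
    · exact ⟨x, hp⟩
    · exact ih h

section Sign

open Classical

attribute [local instance] Fintype.ofFinite

theorem localAut_apply_of_fixed {T : RootedTree.{u}} {c : FirstLevelClass T} {g : T ≃o T}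
    {v : Fiber c} (hv : g v.1.1 = v.1.1) (x : below T (rep c).1) :
    ((tau v).symm (localAut g v x)).1 = g ((tau v).symm x).1 := by
  have hw : fiberPerm c g v = v := Subtype.ext (Subtype.ext hv)
  -- The vertex is generalized so that the equality `hw` can be substituted without transport
  -- between the types `below T w`.
  have key : ∀ (w : Fiber c) (y : below T w.1.1), w = v →
      ((tau v).symm (tau w y)).1 = y.1 := by
    rintro w y rfl
    rw [OrderIso.symm_apply_apply]
  exact key (fiberPerm c g v) (restrictAut g v.1.1 ((tau v).symm x)) hw

theorem localAut_eq_one {T : RootedTree.{u}} {c : FirstLevelClass T} {g : T ≃o T} {v : Fiber c}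
    (hv : ∀ x, v.1.1 ≤ x → g x = x) : localAut g v = 1 := by
  apply OrderIso.ext
  funext x
  apply (tau v).symm.injective
  apply Subtype.ext
  rw [localAut_apply_of_fixed (hv _ le_rfl), hv _ ((tau v).symm x).2]
  rfl

theorem signStep_apply (T : RootedTree.{u}) [Finite T]
    (s : ∀ c : FirstLevelClass T, (below T (rep c).1 ≃o below T (rep c).1) →* ℤˣ) (g : T ≃o T) :
    signStep T s g = Equiv.Perm.sign (firstLevelPerm T g) *
      ∏ c : FirstLevelClass T, ∏ v : Fiber c, s c (localAut g v) := rfl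

/-- The permutation of the first level is a transposition. The local factors at `u` and `v` are
inverse to each other because `g² = 1`, and the other ones are trivial. -/
theorem signStep_swap_firstLevel {T : RootedTree.{u}} [Finite T]
    (s : ∀ c : FirstLevelClass T, (below T (rep c).1 ≃o below T (rep c).1) →* ℤˣ) (g : T ≃o T)
    {u v : T} (hu : ⊥ ⋖ u) (hv : ⊥ ⋖ v) (hne : u ≠ v) (huv : g u = v) (hinv : ∀ x, g (g x) = x)
    (hfix : ∀ x, ¬ u ≤ x → ¬ v ≤ x → g x = x) : signStep T s g = -1 := by
  have h1 : firstLevelPerm T g = Equiv.swap ⟨u, hu⟩ ⟨v, hv⟩ := by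
    ext w
    change g w.1 = _
    by_cases hwu : w = ⟨u, hu⟩
    · rw [hwu, Equiv.swap_apply_left, huv]
    by_cases hwv : w = ⟨v, hv⟩
    · rw [hwv, Equiv.swap_apply_right]
      exact (congrArg g huv).symm.trans (hinv u)
    rw [Equiv.swap_apply_of_ne_of_ne hwu hwv]
    refine hfix _ (fun h => hwu ?_) fun h => hwv ?_
    · exact firstLevel_eq_of_le (u := w) (v := ⟨u, hu⟩) le_rfl h
    · exact firstLevel_eq_of_le (u := w) (v := ⟨v, hv⟩) le_rfl h
  have h2 : ∀ c : FirstLevelClass T, ∏ w : Fiber c, s c (localAut g w) = 1 := by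
    intro c
    refine Finset.prod_involution (fun w _ => fiberPerm c g w) (fun w _ => ?_) (fun w _ h e => h ?_)
      (fun _ _ => Finset.mem_univ _) fun w _ => Subtype.ext (Subtype.ext (hinv _))
    · rw [mul_comm, ← map_mul, ← localAut_mul]
      have : g * g = 1 := OrderIso.ext (funext hinv)
      rw [this, localAut_one, map_one]
    · have e' : g w.1.1 = w.1.1 := congrArg (fun z : Fiber c => z.1.1) e
      rw [localAut_eq_one, map_one]
      intro x hx
      refine hfix x (fun h => hne ?_) fun h => hne ?_
      · have : w.1.1 = u := congrArg Subtype.val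
          (firstLevel_eq_of_le (u := ⟨w.1.1, w.1.2.1⟩) (v := ⟨u, hu⟩) hx h)
        rw [← this, ← e', this, huv]
      · have : w.1.1 = v := congrArg Subtype.val
          (firstLevel_eq_of_le (u := ⟨w.1.1, w.1.2.1⟩) (v := ⟨v, hv⟩) hx h)
        rw [← this, ← e', this, ← huv, hinv]
  rw [signStep_apply, h1, Equiv.Perm.sign_swap (fun h => hne (congrArg Subtype.val h))]
  simp only [h2, Finset.prod_const_one, mul_one]

/-- The first level is fixed pointwise, and the only nontrivial local automorphism sits at the first
level vertex `w` below the swap; it is itself a swap. -/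
theorem signStep_swap_of_le {T : RootedTree.{u}} [Finite T]
    (s : ∀ c : FirstLevelClass T, (below T (rep c).1 ≃o below T (rep c).1) →* ℤˣ)
    (hs : ∀ c g, IsSwap g → s c g = -1) (g : T ≃o T)
    {p u v : T} {w : FirstLevel T} (hw : w.1 ≤ p) (hu : p ⋖ u) (hv : p ⋖ v) (hne : u ≠ v)
    (huv : g u = v) (hinv : ∀ x, g (g x) = x)
    (hfix : ∀ x, ¬ u ≤ x → ¬ v ≤ x → g x = x) : signStep T s g = -1 := by
  have hwi : Internal w.1 := internal_of_lt (hw.trans_lt hu.lt)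
  let w' : InternalFirstLevel T := ⟨w.1, w.2, hwi⟩
  let c := Quotient.mk (isoSetoid T) w'
  let wc : Fiber c := ⟨w', rfl⟩
  have hlt : ∀ z : FirstLevel T, ∀ {y : T}, p ⋖ y → ¬ y ≤ z.1 := fun z y hy h =>
    not_le_bot w (hw.trans (le_parent_of_lt z.2 (hy.lt.trans_le h)))
  have hfix' : ∀ z : FirstLevel T, g z.1 = z.1 := fun z => hfix _ (hlt z hu) (hlt z hv)
  have h1 : firstLevelPerm T g = 1 := Equiv.ext fun z => Subtype.ext (hfix' z)
  have h2 : ∀ z : FirstLevel T, z ≠ w → ∀ x, z.1 ≤ x → g x = x := fun z hz x hx =>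
    hfix x (fun h => hz (firstLevel_eq_of_le hx (hw.trans (hu.le.trans h))))
      fun h => hz (firstLevel_eq_of_le hx (hw.trans (hv.le.trans h)))
  have h3 : IsSwap (localAut g wc) := by
    refine IsSwap.of_subtreeEmb (f := fun x => ((tau wc).symm x).1)
      ((subtreeEmb_val w.1).comp (subtreeEmb_orderIso (tau wc).symm))
      (fun x => localAut_apply_of_fixed (hfix' w) x) ?_ hu hv hne huv hinv hfix
    rw [OrderIso.map_bot]
    exact hw
  rw [signStep_apply, h1, map_one, one_mul, Fintype.prod_eq_single c, Fintype.prod_eq_single wc,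
    hs _ _ h3]
  · intro z hz
    rw [localAut_eq_one, map_one]
    refine h2 ⟨z.1.1, z.1.2.1⟩ fun h => hz ?_
    exact Subtype.ext (Subtype.ext (congrArg (fun y : FirstLevel T => y.1) h))
  · intro c' hc'
    refine Finset.prod_eq_one fun z _ => ?_
    rw [localAut_eq_one, map_one]
    refine h2 ⟨z.1.1, z.1.2.1⟩ fun h => hc' ?_
    have : z.1 = w' := Subtype.ext (congrArg (fun y : FirstLevel T => y.1) h)
    rw [← z.2, this]

theorem treeSign_of_isSwap (n : ℕ) : ∀ (T : RootedTree.{u}) [Finite T], Nat.card T < n →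
    ∀ g : T ≃o T, IsSwap g → treeSign T g = -1 := by
  induction n with
  | zero => exact fun T _ h => absurd h (Nat.not_lt_zero _)
  | succ n ih =>
    rintro T _ hT g ⟨u, v, ⟨p, hu, hv⟩, hne, huv, hinv, hfix⟩
    rw [treeSign]
    by_cases hp : p = ⊥
    · subst hp
      exact signStep_swap_firstLevel _ g hu hv hne huv hinv hfix
    · obtain ⟨w, hw⟩ := exists_firstLevel_le hp
      refine signStep_swap_of_le _ (fun c g hg => ?_) g hw hu hv hne huv hinv hfix
      exact ih _ (by have := card_below_lt (rep c).2.1; omega) g hg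

end Sign

/-- If the automorphisms preserving `φ` and `ψ` have sign `1`, there are no swaps among them. -/
theorem swapFree_of_treeSign {T : RootedTree.{u}} [Finite T] {X Z : Type*} {φ : T → X} {ψ : T → Z}
    (h : ∀ g : T ≃o T, (∀ x, φ (g x) = φ x) → (∀ x, ψ (g x) = ψ x) → treeSign T g = 1) :
    SwapFree φ ψ := by
  rintro u v huv hne ⟨τ, hτ⟩
  obtain ⟨g, hg, hgu, hgv, hgf⟩ := exists_swap huv hne τ
  have key : ∀ x, (φ (g x), ψ (g x)) = (φ x, ψ x) := by
    intro x
    by_cases hu : u ≤ x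
    · rw [hgu ⟨x, hu⟩]
      exact hτ ⟨x, hu⟩
    by_cases hv : v ≤ x
    · rw [hgv ⟨x, hv⟩]
      have := hτ (τ.symm ⟨x, hv⟩)
      simp only [OrderIso.apply_symm_apply] at this
      exact this.symm
    · rw [hgf x hu hv]
  have h1 := h g (fun x => congrArg Prod.fst (key x)) fun x => congrArg Prod.snd (key x)
  rw [treeSign_of_isSwap (Nat.card T + 1) T (Nat.lt_succ_self _) g hg] at h1
  exact absurd h1 (by decide)

/-! ### Counting -/

section Counting

open Classical

/-- The sum of the first `k` odd numbers is `k²`. Removing the maximum `a` of a set with `k + 1`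
elements costs `2a + 1 ≥ 2k + 1`, with equality only if `a = k`. -/
theorem card_mul_card_le_sum (A : Finset ℕ) :
    A.card * A.card ≤ ∑ a ∈ A, (2 * a + 1) ∧
      (A.card * A.card = ∑ a ∈ A, (2 * a + 1) → A = Finset.range A.card) := by
  induction A using Finset.induction_on_max with
  | empty => simp
  | insert a s hs ih =>
    have ha : a ∉ s := fun h => (hs a h).false
    have hc : s.card ≤ a := by
      have : s ⊆ Finset.range a := fun x hx => Finset.mem_range.2 (hs x hx)
      simpa using Finset.card_le_card this
    rw [Finset.card_insert_of_notMem ha, Finset.sum_insert ha]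
    have h1 : (s.card + 1) * (s.card + 1) = s.card * s.card + (2 * s.card + 1) := by ring
    refine ⟨by omega, fun h => ?_⟩
    have h2 : a = s.card := by omega
    have h3 := ih.2 (by omega)
    rw [Finset.range_add_one, ← h3, ← h2]

theorem eq_range_card_of_lower {A : Finset ℕ} (h : ∀ a ∈ A, ∀ k < a, k ∈ A) :
    A = Finset.range A.card := by
  apply Finset.eq_of_subset_of_card_le
  · intro a ha
    have : Finset.range (a + 1) ⊆ A := fun k hk => by
      rcases (Nat.lt_succ_iff.1 (Finset.mem_range.1 hk)).eq_or_lt with rfl | hk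
      · exact ha
      · exact h a ha k hk
    have := Finset.card_le_card this
    rw [Finset.card_range] at this
    exact Finset.mem_range.2 this
  · simp

variable {V X : Type*} [Fintype V]

/-- The number of pairs with the same image. -/
def pairCount (f : V → X) : ℕ := ∑ v, (Finset.univ.filter fun w => f w = f v).card

theorem pairCount_le_card_sq (f : V → X) : pairCount f ≤ Fintype.card V * Fintype.card V := by
  have : pairCount f ≤ ∑ _v : V, Fintype.card V := Finset.sum_le_sum fun v _ => Finset.card_le_univ _
  simpa using this

theorem pairCount_comp {W : Type*} [Fintype W] (e : W ≃ V) (f : V → X) :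
    pairCount (fun w => f (e w)) = pairCount f := by
  unfold pairCount
  rw [← Equiv.sum_comp e]
  refine Finset.sum_congr rfl fun w _ => ?_
  refine Finset.card_bij (fun a _ => e a) (fun a ha => ?_) (fun a _ b _ h => e.injective h) ?_
  · simpa using ha
  · intro b hb
    exact ⟨e.symm b, by simpa using hb, by simp⟩

/-- The labels `j` of the elements of a fiber of `f` are distinct. -/
def LabelInj (f : V → X) (j : V → ℕ) : Prop := ∀ v w, f v = f w → j v = j w → v = w

/-- The labels `j` of the elements of a fiber of `f` form an initial segment. -/
def LabelInit (f : V → X) (j : V → ℕ) : Prop := ∀ v k, k < j v → ∃ w, f w = f v ∧ j w = k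

theorem pairCount_eq_sum (f : V → X) :
    pairCount f = ∑ x ∈ Finset.univ.image f, (Finset.univ.filter fun w => f w = x).card *
      (Finset.univ.filter fun w => f w = x).card := by
  unfold pairCount
  rw [← Finset.sum_fiberwise_of_maps_to (t := Finset.univ.image f) (g := f) (by simp)]
  refine Finset.sum_congr rfl fun x _ => ?_
  rw [Finset.sum_congr rfl (g := fun _ => (Finset.univ.filter fun w => f w = x).card),
    Finset.sum_const, smul_eq_mul]
  intro v hv
  rw [(Finset.mem_filter.1 hv).2]

theorem sum_label_eq_sum (f : V → X) (j : V → ℕ) :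
    ∑ v, (2 * j v + 1) =
      ∑ x ∈ Finset.univ.image f, ∑ v with f v = x, (2 * j v + 1) :=
  (Finset.sum_fiberwise_of_maps_to (by simp) _).symm

theorem LabelInj.injOn {f : V → X} {j : V → ℕ} (h : LabelInj f j) (x : X) :
    Set.InjOn j (Finset.univ.filter fun w => f w = x : Finset V) := fun a ha b hb e => by
  simp only [Finset.coe_filter, Finset.mem_univ, true_and, Set.mem_ofPred_eq] at ha hb
  exact h a b (ha.trans hb.symm) e

theorem LabelInj.sum_image {f : V → X} {j : V → ℕ} (h : LabelInj f j) (x : X) :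
    ∑ v with f v = x, (2 * j v + 1) =
      ∑ a ∈ (Finset.univ.filter fun w => f w = x).image j, (2 * a + 1) :=
  (Finset.sum_image (f := fun a => 2 * a + 1) (h.injOn x)).symm

theorem LabelInj.card_image {f : V → X} {j : V → ℕ} (h : LabelInj f j) (x : X) :
    ((Finset.univ.filter fun w => f w = x).image j).card =
      (Finset.univ.filter fun w => f w = x).card :=
  Finset.card_image_of_injOn (h.injOn x)

theorem pairCount_le {f : V → X} {j : V → ℕ} (h : LabelInj f j) :
    pairCount f ≤ ∑ v, (2 * j v + 1) := by
  rw [pairCount_eq_sum, sum_label_eq_sum f]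
  refine Finset.sum_le_sum fun x _ => ?_
  rw [h.sum_image, ← h.card_image]
  exact (card_mul_card_le_sum _).1

/-- `pairCount_le` is a sum of inequalities, one for each fiber; equality of the totals forces
equality in every fiber, where the labels then fill an initial segment. -/
theorem labelInit_of_pairCount_eq {f : V → X} {j : V → ℕ} (h : LabelInj f j)
    (he : pairCount f = ∑ v, (2 * j v + 1)) : LabelInit f j := by
  rw [pairCount_eq_sum, sum_label_eq_sum f, Finset.sum_eq_sum_iff_of_le] at he
  · intro v k hk
    have := he (f v) (by simp)
    rw [h.sum_image, ← h.card_image] at this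
    have h2 := (card_mul_card_le_sum _).2 this
    have hv : j v ∈ (Finset.univ.filter fun w => f w = f v).image j :=
      Finset.mem_image_of_mem _ (by simp)
    have hk' : k ∈ (Finset.univ.filter fun w => f w = f v).image j := by
      rw [h2, Finset.mem_range] at hv ⊢
      exact hk.trans hv
    simpa using hk'
  · intro x _
    rw [h.sum_image, ← h.card_image]
    exact (card_mul_card_le_sum _).1

theorem LabelInit.image_eq {f : V → X} {j : V → ℕ} (hi : LabelInit f j) (h : LabelInj f j) (x : X) :
    (Finset.univ.filter fun w => f w = x).image j =
      Finset.range (Finset.univ.filter fun w => f w = x).card := by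
  rw [← h.card_image]
  refine eq_range_card_of_lower fun a ha k hk => ?_
  simp only [Finset.mem_image, Finset.mem_filter, Finset.mem_univ, true_and] at ha ⊢
  obtain ⟨v, hv, rfl⟩ := ha
  obtain ⟨w, hw, rfl⟩ := hi v k hk
  exact ⟨w, hw.trans hv, rfl⟩

theorem sum_range_odd (n : ℕ) : ∑ a ∈ Finset.range n, (2 * a + 1) = n * n := by
  induction n with
  | zero => rfl
  | succ n ih => rw [Finset.sum_range_succ, ih]; ring

theorem LabelInit.pairCount_eq {f : V → X} {j : V → ℕ} (hi : LabelInit f j) (h : LabelInj f j) :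
    pairCount f = ∑ v, (2 * j v + 1) := by
  rw [pairCount_eq_sum, sum_label_eq_sum f]
  refine Finset.sum_congr rfl fun x _ => ?_
  rw [h.sum_image, hi.image_eq h, sum_range_odd]

/-- Two initial labelings of the fibers of `f` differ by a permutation preserving the fibers. -/
theorem exists_perm_of_labelInit {f : V → X} {j j' : V → ℕ} (h : LabelInj f j)
    (hi : LabelInit f j) (h' : LabelInj f j') (hi' : LabelInit f j') :
    ∃ σ : V ≃ V, ∀ v, f (σ v) = f v ∧ j' (σ v) = j v := by
  have hex : ∀ v, ∃ w, f w = f v ∧ j' w = j v := by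
    intro v
    have hv : j v ∈ (Finset.univ.filter fun w => f w = f v).image j :=
      Finset.mem_image_of_mem _ (by simp)
    rw [hi.image_eq h, ← hi'.image_eq h'] at hv
    simpa using hv
  choose σ hσ hσ' using hex
  have hinj : Function.Injective σ := fun a b e =>
    h a b (by rw [← hσ a, e, hσ b]) (by rw [← hσ' a, e, hσ' b])
  exact ⟨Equiv.ofBijective σ (Finite.injective_iff_bijective.1 hinj), fun v => ⟨hσ v, hσ' v⟩⟩

theorem exists_equiv_of_card_fiber {S S' K : Type*} [Fintype S] [Fintype S'] {f : S → K}
    {g : S' → K} (h : ∀ k, Nat.card {s // f s = k} = Nat.card {s // g s = k}) : ∃ e : S ≃ S', ∀ s, g (e s) = f s := by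
  have h' : ∀ k, Nonempty ({s // f s = k} ≃ {s // g s = k}) := fun k =>
    ⟨(Finite.card_eq.1 (h k)).some⟩
  exact ⟨Equiv.ofFiberEquiv fun k => (h' k).some, Equiv.ofFiberEquiv_map _⟩

/-- The elements with the largest label in their fiber. -/
def IsLast (f : V → X) (j : V → ℕ) (v : V) : Prop := ∀ w, f w = f v → j w ≤ j v

theorem exists_isLast (f : V → X) (j : V → ℕ) (v : V) : ∃ w, f w = f v ∧ IsLast f j w := by
  obtain ⟨w, hw, hm⟩ := Finset.exists_max_image (Finset.univ.filter fun w => f w = f v) j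
    ⟨v, by simp⟩
  simp only [Finset.mem_filter, Finset.mem_univ, true_and] at hw hm
  exact ⟨w, hw, fun z hz => hm z (hz.trans hw)⟩

/-- Passing to the next label in the same fiber is a bijection from the non-last elements with label
`k` to the elements with label `k + 1`. Consequently the number of fibers of size `k + 1` in the
class `i` depends only on `c` and `j`. -/
theorem card_isLast {I : Type*} {c : V → I} {f : V → X} {j : V → ℕ}
    (hc : ∀ v w, f v = f w → c v = c w) (h : LabelInj f j) (hi : LabelInit f j) (i : I) (k : ℕ) :
    (Finset.univ.filter fun v => IsLast f j v ∧ c v = i ∧ j v = k).card +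
      (Finset.univ.filter fun v => c v = i ∧ j v = k + 1).card =
    (Finset.univ.filter fun v => c v = i ∧ j v = k).card := by
  have hs : ∀ v, ¬ IsLast f j v → ∃ w, f w = f v ∧ j w = j v + 1 := by
    intro v hv
    simp only [IsLast, not_forall, not_le] at hv
    obtain ⟨w, hw, hlt⟩ := hv
    rcases (Nat.succ_le_of_lt hlt).eq_or_lt with he | hlt
    · exact ⟨w, hw, he.symm⟩
    · obtain ⟨z, hz, hz'⟩ := hi w _ hlt
      exact ⟨z, hz.trans hw, hz'⟩
  have key : (Finset.univ.filter fun v => ¬ IsLast f j v ∧ c v = i ∧ j v = k).card =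
      (Finset.univ.filter fun v => c v = i ∧ j v = k + 1).card := by
    choose! σ hσ hσ' using hs
    refine Finset.card_bij (fun v _ => σ v) ?_ ?_ ?_
    · intro v hv
      simp only [Finset.mem_filter, Finset.mem_univ, true_and] at hv ⊢
      exact ⟨(hc _ _ (hσ v hv.1)).trans hv.2.1, by rw [hσ' v hv.1, hv.2.2]⟩
    · intro v hv w hw e
      simp only [Finset.mem_filter, Finset.mem_univ, true_and] at hv hw
      exact h v w (by rw [← hσ v hv.1, e, hσ w hw.1]) (hv.2.2.trans hw.2.2.symm)
    · intro w hw
      simp only [Finset.mem_filter, Finset.mem_univ, true_and] at hw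
      obtain ⟨v, hv, hvk⟩ := hi w k (by omega)
      have hv' : ¬ IsLast f j v := fun hl => by
        have := hl w hv.symm
        omega
      refine ⟨v, ?_, ?_⟩
      · simp only [Finset.mem_filter, Finset.mem_univ, true_and]
        exact ⟨hv', (hc _ _ hv).trans hw.1, hvk⟩
      · exact h _ _ ((hσ v hv').trans hv) (by rw [hσ' v hv', hvk, hw.2])
  rw [← key, ← Finset.card_filter_add_card_filter_not (s := Finset.univ.filter fun v => c v = i ∧ j v = k)
    (IsLast f j), Finset.filter_filter, Finset.filter_filter]
  congr 2 <;> ext v <;> simp <;> tauto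

/-- Two partitions of `V`, refining the same partition and initially labeled by the same function,
differ by a permutation. -/
theorem exists_perm_of_label {Y I : Type*} {c : V → I} {f : V → X} {f' : V → Y} {j : V → ℕ}
    (hc : ∀ v w, f v = f w → c v = c w) (h : LabelInj f j) (hi : LabelInit f j)
    (hc' : ∀ v w, f' v = f' w → c v = c w) (h' : LabelInj f' j) (hi' : LabelInit f' j) :
    ∃ σ : V ≃ V, (∀ v, c (σ v) = c v) ∧ ∀ v w, f v = f w ↔ f' (σ v) = f' (σ w) := by
  -- Last elements stand for blocks, and their label is the size minus one: `e` matches the blocks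
  -- of `f` and `f'` with the same class and size.
  obtain ⟨e, he⟩ := exists_equiv_of_card_fiber (S := {v // IsLast f j v})
    (S' := {v // IsLast f' j v}) (f := fun v => (c v.1, j v.1)) (g := fun v => (c v.1, j v.1)) (by
      rintro ⟨i, k⟩
      have h1 := card_isLast hc h hi i k
      have h2 := card_isLast hc' h' hi' i k
      have key : ∀ P : V → Prop, Nat.card {s : {v // P v} // (c s.1, j s.1) = (i, k)} =
          (Finset.univ.filter fun v => P v ∧ c v = i ∧ j v = k).card := by
        intro P
        rw [Nat.card_eq_fintype_card, Fintype.card_subtype]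
        refine Finset.card_bij (fun v _ => v.1) ?_ (fun a _ b _ => Subtype.ext) ?_
        · intro v hv
          simp only [Finset.mem_filter, Finset.mem_univ, true_and, Prod.mk.injEq] at hv ⊢
          exact ⟨v.2, hv⟩
        · intro v hv
          simp only [Finset.mem_filter, Finset.mem_univ, true_and] at hv
          exact ⟨⟨v, hv.1⟩, by simpa using hv.2, rfl⟩
      rw [key, key]
      omega)
  have hlast : ∀ v, ∃ w : {v // IsLast f j v}, f w.1 = f v := fun v => by
    obtain ⟨w, hw, hl⟩ := exists_isLast f j v
    exact ⟨⟨w, hl⟩, hw⟩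
  choose l hl using hlast
  -- `v` is sent to the element with the same label in the block of `f'` matched with its own.
  have hle : ∀ v, ∃ w, f' w = f' (e (l v)).1 ∧ j w = j v := by
    intro v
    have h1 : j v ≤ j (l v).1 := (l v).2 v (hl v).symm
    have h2 : j (e (l v)).1 = j (l v).1 := congrArg Prod.snd (he (l v))
    rcases h1.eq_or_lt with h3 | h3
    · exact ⟨_, rfl, h2.trans h3.symm⟩
    · exact hi' _ _ (h2 ▸ h3)
  choose σ hσ hσ' using hle
  have hiff : ∀ v w, f v = f w ↔ f' (σ v) = f' (σ w) := by
    intro v w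
    rw [hσ, hσ]
    refine ⟨fun hvw => ?_, fun hvw => ?_⟩
    · rw [show l v = l w from Subtype.ext (h _ _ ((hl v).trans (hvw.trans (hl w).symm))
        (le_antisymm ((l w).2 _ ((hl v).trans (hvw.trans (hl w).symm)))
          ((l v).2 _ ((hl w).trans (hvw.symm.trans (hl v).symm)))))]
    · have : e (l v) = e (l w) := Subtype.ext (h' _ _ hvw
        (le_antisymm ((e (l w)).2 _ hvw) ((e (l v)).2 _ hvw.symm)))
      rw [← hl v, ← hl w, e.injective this]
  have hinj : Function.Injective σ := fun a b hab =>
    h a b ((hiff a b).2 (by rw [hab])) (by rw [← hσ' a, hab, hσ' b])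
  refine ⟨Equiv.ofBijective σ (Finite.injective_iff_bijective.1 hinj), fun v => ?_, hiff⟩
  exact (hc' _ _ (hσ v)).trans ((congrArg Prod.fst (he (l v))).trans (hc _ _ (hl v)))

end Counting

/-! ### Conjugate partitions -/

section Conjugate

open Classical

/-- In a nonincreasing list the entries larger than `k` form a prefix. -/
theorem lt_countP_iff {l : List ℕ} (hl : l.Pairwise (· ≥ ·)) (i k : ℕ) :
    (∃ h : i < l.length, k < l[i]) ↔ i < l.countP (k < ·) := by
  induction l generalizing i with
  | nil => simp
  | cons a l ih =>
    rw [List.pairwise_cons] at hl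
    by_cases hka : k < a
    · rw [List.countP_cons_of_pos (by simpa using hka)]
      cases i with
      | zero => simpa using hka
      | succ i => simpa using ih hl.2 i
    · have h0 : l.countP (k < ·) = 0 := by
        rw [List.countP_eq_zero]
        intro b hb
        have := hl.1 b hb
        simp
        omega
      rw [List.countP_cons_of_neg (by simpa using hka), h0]
      refine iff_of_false ?_ (Nat.not_lt_zero _)
      rintro ⟨h, h'⟩
      cases i with
      | zero => exact hka (by simpa using h')
      | succ i =>
        simp only [List.length_cons, Nat.succ_lt_succ_iff] at h
        have := hl.1 l[i] (List.getElem_mem _)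
        simp only [List.getElem_cons_succ] at h'
        omega

theorem mem_diagram {m : Multiset ℕ} {i k : ℕ} :
    (i, k) ∈ diagram m ↔ i < m.countP (k < ·) := by
  rw [diagram, YoungDiagram.mem_ofRowLens]
  refine (lt_countP_iff (Multiset.pairwise_sort m (· ≥ ·)) i k).trans ?_
  rw [← Multiset.coe_countP, Multiset.sort_eq]

theorem card_filter_lt {R : Type*} [Fintype R] (c : R → ℕ) (n : ℕ) :
    (Finset.univ.filter fun s => n < c s).card = (Finset.univ.filter fun s => n + 1 < c s).card +
      (Finset.univ.filter fun s => c s = n + 1).card := by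
  rw [← Finset.card_union_of_disjoint]
  · congr 1
    ext s
    simp
    omega
  · rw [Finset.disjoint_filter]
    intro s _ h
    omega

theorem countP_map_lt {Z : Type*} (s : Finset Z) (a : Z → ℕ) (k : ℕ) :
    (s.val.map a).countP (k < ·) = (s.filter fun z => k < a z).card := by
  rw [Multiset.countP_map]
  rfl

/-- The counts above every `k` determine how often each positive value occurs; equality of the
cardinalities settles the value `0`. -/
theorem exists_equiv_of_card_lt {S S' : Type*} [Fintype S] [Fintype S'] {a : S → ℕ} {b : S' → ℕ}
    (h : Fintype.card S = Fintype.card S')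
    (hk : ∀ k, (Finset.univ.filter fun s => k < a s).card =
      (Finset.univ.filter fun s => k < b s).card) : ∃ e : S ≃ S', ∀ s, b (e s) = a s := by
  apply exists_equiv_of_card_fiber
  intro n
  rw [Nat.card_eq_fintype_card, Nat.card_eq_fintype_card, Fintype.card_subtype,
    Fintype.card_subtype]
  cases n with
  | zero =>
    have h1 := Finset.card_filter_add_card_filter_not (s := (Finset.univ : Finset S)) fun s => 0 < a s
    have h2 := Finset.card_filter_add_card_filter_not (s := (Finset.univ : Finset S')) fun s => 0 < b s
    have h3 := hk 0
    simp only [Nat.pos_iff_ne_zero, not_not, Finset.card_univ] at h1 h2 h3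
    omega
  | succ n =>
    have h1 := card_filter_lt a n
    have h2 := card_filter_lt b n
    rw [hk n, hk (n + 1)] at h1
    omega

/-- Two partitions of `V`, with conjugate types and with `0`-`1` intersection: a labeling of the
blocks of the second induces an initial labeling of the blocks of the first. -/
theorem exists_label_of_conjugate {V X Y : Type*} [Fintype V] {f : V → X} {p : V → Y}
    {sX : Finset X} {sY : Finset Y} (hX : ∀ v, f v ∈ sX) (hY : ∀ v, p v ∈ sY)
    (h01 : ∀ v w, f v = f w → p v = p w → v = w)
    (hconj : diagram (sY.val.map fun y => (Finset.univ.filter fun v => p v = y).card) =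
      (diagram (sX.val.map fun x => (Finset.univ.filter fun v => f v = x).card)).transpose) :
    ∃ j : Y → ℕ, (∀ v w, j (p v) = j (p w) → p v = p w) ∧ LabelInit f fun v => j (p v) := by
  set μ : X → ℕ := fun x => (Finset.univ.filter fun v => f v = x).card with hμ
  set ν : Y → ℕ := fun y => (Finset.univ.filter fun v => p v = y).card with hν
  set c : ℕ → ℕ := fun i => (sX.filter fun x => i < μ x).card with hc
  -- Both sides say that the cell `(i, k)` lies in the diagram of `ν`. Hence `c` lists the positive
  -- sizes of the blocks of `p` in nonincreasing order.
  have hmem : ∀ i k, i < (sY.filter fun y => k < ν y).card ↔ k < c i := by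
    intro i k
    have : (i, k) ∈ diagram (sY.val.map ν) ↔ (k, i) ∈ diagram (sX.val.map μ) := by
      rw [hconj, YoungDiagram.mem_transpose]
      rfl
    rwa [mem_diagram, mem_diagram, countP_map_lt, countP_map_lt] at this
  -- The blocks of `p` are numbered so that block number `i` has `c i` elements, as many as there
  -- are blocks of `f` with more than `i` elements.
  obtain ⟨e, he⟩ := exists_equiv_of_card_lt (S := sY) (S' := Fin sY.card) (a := fun y => ν y.1)
    (b := fun i => c i.1) (by simp) (by
      intro k
      have h1 : (Finset.univ.filter fun y : sY => k < ν y.1).card =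
          (sY.filter fun y => k < ν y).card := by
        refine Finset.card_bij (fun y _ => y.1) ?_ (fun a _ b _ => Subtype.ext) ?_
        · intro y hy
          simpa using hy
        · intro y hy
          simp only [Finset.mem_filter] at hy
          exact ⟨⟨y, hy.1⟩, by simpa using hy.2, rfl⟩
      have h2 : (Finset.univ.filter fun i : Fin sY.card => k < c i.1).card =
          (Finset.range (sY.filter fun y => k < ν y).card).card := by
        refine Finset.card_bij (fun i _ => i.1) ?_ (fun a _ b _ => Fin.ext) ?_
        · intro i hi
          simpa [hmem] using hi
        · intro i hi
          have hi' := Finset.mem_range.1 hi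
          exact ⟨⟨i, hi'.trans_le (Finset.card_filter_le _ _)⟩, by simpa [hmem] using hi, rfl⟩
      rw [h1, h2, Finset.card_range])
  -- The value `0` outside `sY` is immaterial, since `p` takes its values in `sY`.
  let j : Y → ℕ := fun y => if h : y ∈ sY then (e ⟨y, h⟩).1 else 0
  have hj : ∀ y : sY, j y.1 = (e y).1 := fun y => dif_pos y.2
  have hjinj : ∀ v w, j (p v) = j (p w) → p v = p w := by
    intro v w h
    rw [hj ⟨p v, hY v⟩, hj ⟨p w, hY w⟩] at h
    exact congrArg Subtype.val (e.injective (Fin.ext h))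
  refine ⟨j, hjinj, labelInit_of_pairCount_eq (fun v w hf hp => h01 v w hf (hjinj v w hp)) ?_⟩
  -- For the other inequality, `∑ (2j + 1)` is computed along the columns and then reorganized by
  -- rows: a row of size `μ x` receives the terms with `i < μ x`, at most `(μ x)²` in total.
  refine le_antisymm (pairCount_le fun v w hf hp => h01 v w hf (hjinj v w hp)) ?_
  have h1 : ∑ v, (2 * j (p v) + 1) = ∑ y ∈ sY, ν y * (2 * j y + 1) := by
    rw [← Finset.sum_fiberwise_of_maps_to (t := sY) (g := p) fun v _ => hY v]
    refine Finset.sum_congr rfl fun y _ => ?_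
    rw [Finset.sum_congr rfl (g := fun _ => 2 * j y + 1), Finset.sum_const, smul_eq_mul]
    intro v hv
    rw [(Finset.mem_filter.1 hv).2]
  have h2 : ∑ y ∈ sY, ν y * (2 * j y + 1) = ∑ i ∈ Finset.range sY.card, c i * (2 * i + 1) := by
    rw [← Finset.sum_coe_sort, Finset.sum_range, ← Equiv.sum_comp e]
    refine Finset.sum_congr rfl fun y _ => ?_
    rw [hj, he]
  have h3 : ∑ i ∈ Finset.range sY.card, c i * (2 * i + 1) =
      ∑ x ∈ sX, ∑ i ∈ Finset.range sY.card with i < μ x, (2 * i + 1) := by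
    simp only [hc, Finset.card_filter, Finset.sum_mul, Finset.sum_filter]
    rw [Finset.sum_comm]
    refine Finset.sum_congr rfl fun x _ => Finset.sum_congr rfl fun i _ => ?_
    split_ifs <;> simp
  have h4 : ∀ x, ∑ i ∈ Finset.range sY.card with i < μ x, (2 * i + 1) ≤ μ x * μ x := by
    intro x
    rw [← sum_range_odd]
    refine Finset.sum_le_sum_of_subset fun i hi => ?_
    simp only [Finset.mem_filter, Finset.mem_range] at hi ⊢
    exact hi.2
  have h5 : pairCount f = ∑ x ∈ sX, μ x * μ x := by
    rw [pairCount_eq_sum]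
    refine Finset.sum_subset (fun x hx => ?_) fun x _ hx => ?_
    · obtain ⟨v, _, rfl⟩ := Finset.mem_image.1 hx
      exact hX v
    · have : μ x = 0 := by
        rw [hμ]
        simp only [Finset.card_eq_zero, Finset.filter_eq_empty_iff]
        rintro v - rfl
        exact hx (Finset.mem_image_of_mem _ (Finset.mem_univ _))
      change μ x * μ x = 0
      rw [this]
  rw [h1, h2, h3, h5]
  exact Finset.sum_le_sum fun x _ => h4 x

end Conjugate

/-! ### Tableaux -/

/-- The pair `(θ, ψ)` is transposed, with initial labeling `j`: the fibers of `ψ` on the children of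
a vertex, in a class of equivalent restrictions of `θ`, are the columns of a Young tableau with
entries these children and with rows the fibers of `θ`; and `j` is the number of the column. -/
structure Tableau {T : RootedTree.{u}} {X Z : Type*} (θ : T → X) (ψ : T → Z) (j : T → ℕ) :
    Prop where
  regular : Regular θ
  regular' : Regular ψ
  kerEquiv : ∀ v w, Siblings v w → ψ v = ψ w → KerEquiv (res θ v) (res θ w)
  label : ∀ v w, Siblings v w → ψ v = ψ w → j v = j w
  eq_of_label : ∀ v w, Siblings v w → KerEquiv (res θ v) (res θ w) → j v = j w → ψ v = ψ w
  inj : ∀ v w, Siblings v w → θ v = θ w → j v = j w → v = w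
  init : ∀ p v k, p ⋖ v → k < j v → ∃ w, p ⋖ w ∧ θ w = θ v ∧ j w = k

theorem Tableau.comp {S T : RootedTree.{u}} {X Z : Type*} {θ : T → X} {ψ : T → Z} {j : T → ℕ}
    (h : Tableau θ ψ j) {f : S → T} (hf : SubtreeEmb f) :
    Tableau (fun x => θ (f x)) (fun x => ψ (f x)) fun x => j (f x) where
  regular := h.regular.comp hf
  regular' := h.regular'.comp hf
  kerEquiv v w hs e := ((hf.strictEquiv θ v).kerEquiv.trans (h.kerEquiv _ _ (hf.siblings hs) e)).trans
    (hf.strictEquiv θ w).symm.kerEquiv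
  label v w hs e := h.label _ _ (hf.siblings hs) e
  eq_of_label v w hs e := h.eq_of_label _ _ (hf.siblings hs)
    (((hf.strictEquiv θ v).symm.kerEquiv.trans e).trans (hf.strictEquiv θ w).kerEquiv)
  inj v w hs e e' := hf.injective (h.inj _ _ (hf.siblings hs) e e')
  init p v k hp hk := by
    obtain ⟨w, hw, h1, h2⟩ := h.init (f p) (f v) k ((hf.covBy_iff _ _).2 hp) hk
    obtain ⟨w, rfl⟩ := hf.upper _ w hw.le
    exact ⟨w, (hf.covBy_iff _ _).1 hw, h1, h2⟩

theorem Tableau.congr {T : RootedTree.{u}} {X X' Z : Type*} {θ : T → X} {θ' : T → X'} {ψ : T → Z}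
    {j : T → ℕ} (h : Tableau θ ψ j) (hr : Regular θ') (hθ : ∀ x y, θ' x = θ' y ↔ θ x = θ y) :
    Tableau θ' ψ j := by
  have hk : ∀ v, KerEquiv (res θ' v) (res θ v) := fun v =>
    ⟨OrderIso.refl _, fun x y => hθ x.1 y.1⟩
  exact
  { regular := hr
    regular' := h.regular'
    kerEquiv := fun v w hs e => ((hk v).trans (h.kerEquiv v w hs e)).trans (hk w).symm
    label := h.label
    eq_of_label := fun v w hs e => h.eq_of_label v w hs (((hk v).symm.trans e).trans (hk w))
    inj := fun v w hs e => h.inj v w hs ((hθ v w).1 e)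
    init := fun p v k hp hk => by
      obtain ⟨w, hw, h1, h2⟩ := h.init p v k hp hk
      exact ⟨w, hw, (hθ _ _).2 h1, h2⟩ }

/-! ### Weights and the uniqueness of the transpose -/

section Weight

attribute [local instance] Fintype.ofFinite

/-- A weighted count of the pairs of siblings with the same image; the weight of the pairs grows
with their depth. -/
def weight (N : ℕ) (T : RootedTree.{u}) [Finite T] {X : Type*} (φ : T → X) : ℕ :=
  pairCount (fun v : FirstLevel T => φ v.1) +
    N * ∑ v : FirstLevel T, weight N (below T v.1) (res φ v.1)
termination_by Nat.card T
decreasing_by exact card_below_lt v.2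

/-- The bijection between the first levels induced by an isomorphism. -/
def firstLevelEquiv {S T : RootedTree.{u}} (e : S ≃o T) : FirstLevel S ≃ FirstLevel T :=
  e.toEquiv.subtypeEquiv fun v => by
    have h := apply_covBy_apply_iff e (a := ⊥) (b := v)
    rw [OrderIso.map_bot] at h
    exact h.symm

theorem weight_comp (N n : ℕ) {X : Type*} : ∀ (S T : RootedTree.{u}) [Finite S] [Finite T],
    Nat.card S < n → ∀ (e : S ≃o T) (φ : T → X), weight N S (fun x => φ (e x)) = weight N T φ := by
  induction n with
  | zero => exact fun S T _ _ h => absurd h (Nat.not_lt_zero _)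
  | succ n ih =>
    intro S T _ _ hn e φ
    rw [weight, weight]
    congr 1
    · exact pairCount_comp (firstLevelEquiv e) fun v => φ v.1
    · rw [← Equiv.sum_comp (firstLevelEquiv e)]
      congr 1
      refine Finset.sum_congr rfl fun v _ => ?_
      exact ih (below S v.1) (below T (e v.1)) (by have := card_below_lt v.2; omega)
        ((subtreeEmb_orderIso e).belowIso v.1) (res φ (e v.1))

/-- The comparison of the weights. -/
def WeightLe (N : ℕ) (X Z : Type*) (T : RootedTree.{u}) [Finite T] : Prop :=
  ∀ (θ : T → X) (ψ : T → Z) (j : T → ℕ) (φ : T → X), Tableau θ ψ j → Regular φ → SwapFree φ ψ →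
    weight N T φ ≤ weight N T θ ∧ (weight N T φ = weight N T θ → KerEquiv φ θ)

/-- The uniqueness of the transpose up to automorphisms preserving `φ`. -/
def TransposeUnique (X Z : Type*) (T : RootedTree.{u}) : Prop :=
  ∀ (φ : T → X) (ψ ψ' : T → Z) (j : T → ℕ), Tableau φ ψ j → StrictEquiv ψ' ψ → SwapFree φ ψ' →
    ∃ h : T ≃o T, (∀ x, φ (h x) = φ x) ∧ ∀ x, ψ' (h x) = ψ x

/-- Transport the tableau `(θ, ψ)` on `T_u` along `ε` to a tableau with first map `φ`. The
restrictions of `ψ` to `T_u` and, through `τ₁`, to `T_v` are both swap-free with respect to `φ` and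
isomorphic to its second map. By uniqueness on `T_u` both become that map after automorphisms
preserving `φ`. This gives an isomorphism `T_u → T_v` preserving `φ` and `ψ`, which swap-freeness
allows only if `u = v`. -/
theorem eq_of_swapFree {X Z : Type*} {T : RootedTree.{u}}
    (hB : ∀ u : FirstLevel T, TransposeUnique X Z (below T u.1))
    {φ θ : T → X} {ψ : T → Z} {j : T → ℕ} (hθ : Tableau θ ψ j) (hφ : Regular φ)
    (hs : SwapFree φ ψ) {u v : FirstLevel T} (h1 : φ u.1 = φ v.1) (h2 : ψ u.1 = ψ v.1)
    (hk : KerEquiv (res φ u.1) (res θ u.1)) : u = v := by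
  have huv := siblings_firstLevel u v
  obtain ⟨ε, hε⟩ := hk
  obtain ⟨τ₁, hτ₁⟩ := hφ.strict _ _ huv h1
  obtain ⟨τ₂, hτ₂⟩ := hθ.regular'.strict _ _ huv h2
  have ht : Tableau (res φ u.1) (fun x => res ψ u.1 (ε x)) fun x => j (ε x).1 :=
    ((hθ.comp (subtreeEmb_val u.1)).comp (subtreeEmb_orderIso ε)).congr
      (hφ.comp (subtreeEmb_val u.1)) hε
  obtain ⟨h, hh, hh'⟩ := hB u _ _ (res ψ u.1) _ ht
    ⟨ε.symm, fun x => by simp only [OrderIso.apply_symm_apply]⟩ (hs.comp (subtreeEmb_val u.1))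
  have hs' : SwapFree (res φ u.1) fun x => res ψ v.1 (τ₁ x) := by
    have := (hs.comp (subtreeEmb_val v.1)).comp (subtreeEmb_orderIso τ₁)
    rwa [show (fun x => φ (τ₁ x).1) = res φ u.1 from funext hτ₁] at this
  obtain ⟨k, hk, hk'⟩ := hB u _ _ _ _ ht ⟨(τ₁.trans τ₂.symm).trans ε.symm, fun x => by
    simp only [OrderIso.trans_apply, OrderIso.apply_symm_apply, ← hτ₂]⟩ hs'
  refine Subtype.ext (hs.ne huv ((h.symm.trans k).trans τ₁) (fun x => ?_) fun x => ?_)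
  · have := hh (h.symm x)
    rw [h.apply_symm_apply] at this
    exact (hτ₁ _).trans ((hk _).trans this.symm)
  · have := hh' (h.symm x)
    rw [h.apply_symm_apply] at this
    exact (hk' _).trans this.symm

theorem Tableau.labelInj {X Z : Type*} {T : RootedTree.{u}} {θ : T → X} {ψ : T → Z} {j : T → ℕ}
    (h : Tableau θ ψ j) : LabelInj (fun v : FirstLevel T => θ v.1) fun v => j v.1 := fun v w e e' =>
  Subtype.ext (h.inj _ _ (siblings_firstLevel v w) e e')

theorem Tableau.labelInit {X Z : Type*} {T : RootedTree.{u}} {θ : T → X} {ψ : T → Z} {j : T → ℕ}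
    (h : Tableau θ ψ j) : LabelInit (fun v : FirstLevel T => θ v.1) fun v => j v.1 := fun v k hk => by
  obtain ⟨w, hw, h1, h2⟩ := h.init ⊥ v.1 k v.2 hk
  exact ⟨⟨w, hw⟩, h1, h2⟩

/-- Gluing of equivalences of the first level subtrees. -/
theorem kerEquiv_of_firstLevel {X Y : Type*} {T : RootedTree.{u}} {φ : T → X} {θ : T → Y}
    (hφ : Regular φ) (hθ : Regular θ) (σ : FirstLevel T ≃ FirstLevel T)
    (hσ : ∀ v w, φ v.1 = φ w.1 ↔ θ (σ v).1 = θ (σ w).1)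
    (hk : ∀ v : FirstLevel T, KerEquiv (res φ v.1) (res θ (σ v).1)) : KerEquiv φ θ := by
  choose E hE using hk
  let f : FirstLevel T → X := fun v => φ v.1
  -- One representative is fixed for each fiber of `φ`. The isomorphism on `T_v` is routed through
  -- `E (r v)`, so that different subtrees over the same fiber use the same comparison with `θ`;
  -- independent choices `E v` need not be compatible.
  let r : FirstLevel T → FirstLevel T := fun v =>
    Set.rangeSplitting f (Set.rangeFactorization f v)
  have hr : ∀ v, φ (r v).1 = φ v.1 := fun v => Set.apply_rangeSplitting f _
  have hrr : ∀ v w, φ v.1 = φ w.1 → r v = r w := fun v w h =>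
    congrArg (Set.rangeSplitting f) (Subtype.ext h)
  choose α hα using fun v => hφ.strict _ _ (siblings_firstLevel v (r v)) (hr v).symm
  choose β hβ using fun v =>
    hθ.strict _ _ (siblings_firstLevel (σ (r v)) (σ v)) ((hσ _ _).1 (hr v))
  obtain ⟨ε, hε⟩ := exists_glue σ fun v => ((α v).trans (E (r v))).trans (β v)
  have hE' : ∀ (a b : FirstLevel T) (_ : a = b) (x : below T a.1) (y : below T b.1),
      φ x.1 = φ y.1 ↔ θ (E a x).1 = θ (E b y).1 := by
    rintro a _ rfl x y
    exact hE a x y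
  refine ⟨ε, fun x y => ?_⟩
  have hbε : ∀ x, ⊥ = ε x ↔ ⊥ = x := fun x =>
    ⟨fun h => ε.injective (ε.map_bot.trans h), fun h => by rw [← h, ε.map_bot]⟩
  by_cases hx : x = ⊥
  · subst hx
    rw [ε.map_bot]
    exact ⟨fun h => congrArg θ ((hbε y).2 (hφ.eq_of_le _ _ bot_le h)),
      fun h => congrArg φ ((hbε y).1 (hθ.eq_of_le _ _ bot_le h))⟩
  by_cases hy : y = ⊥
  · subst hy
    rw [ε.map_bot]
    exact ⟨fun h => congrArg θ ((hbε x).2 (hφ.eq_of_le _ _ bot_le h.symm)).symm,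
      fun h => congrArg φ ((hbε x).1 (hθ.eq_of_le _ _ bot_le h.symm)).symm⟩
  obtain ⟨v, hv⟩ := exists_firstLevel_le hx
  obtain ⟨w, hw⟩ := exists_firstLevel_le hy
  have h1 := hε v ⟨x, hv⟩
  have h2 := hε w ⟨y, hw⟩
  have h3 : (σ v).1 ≤ ε x := h1 ▸ Subtype.prop _
  have h4 : (σ w).1 ≤ ε y := h2 ▸ Subtype.prop _
  by_cases hvw : φ v.1 = φ w.1
  · have := hE' _ _ (hrr v w hvw) (α v ⟨x, hv⟩) (α w ⟨y, hw⟩)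
    have h5 : θ (ε x) = θ (E (r v) (α v ⟨x, hv⟩)).1 := (congrArg θ h1).trans (hβ v _)
    have h6 : θ (ε y) = θ (E (r w) (α w ⟨y, hw⟩)).1 := (congrArg θ h2).trans (hβ w _)
    have h7 : φ (α v ⟨x, hv⟩).1 = φ x := hα v _
    have h8 : φ (α w ⟨y, hw⟩).1 = φ y := hα w _
    rwa [h5, h6, ← h7, ← h8]
  · exact iff_of_false (fun h => hvw (hφ.firstLevel_eq x y hv hw h)) fun h =>
      hvw ((hσ v w).2 (hθ.firstLevel_eq _ _ h3 h4 h))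

/-- The top level contributes less than `N`, so the comparison is lexicographic with the deeper
levels first. If these tie, every subtree of `φ` is equivalent to that of `θ`. Then `eq_of_swapFree`
shows that `j` is injective on the fibers of `φ`, and the top level is bounded by `∑ (2j + 1)`, the
value for `θ`. If that is also a tie, `j` is an initial labeling for both maps, and the fibers can
be matched within the classes of equivalent subtrees. -/
theorem weightLe_of_firstLevel {N : ℕ} {X Z : Type*} {T : RootedTree.{u}} [Finite T]
    (hN : Nat.card T * Nat.card T < N)
    (hA : ∀ u : FirstLevel T, WeightLe N X Z (below T u.1))
    (hB : ∀ u : FirstLevel T, TransposeUnique X Z (below T u.1)) : WeightLe N X Z T := by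
  intro θ ψ j φ hθ hφ hs
  have hA' := fun u : FirstLevel T => hA u (res θ u.1) (res ψ u.1) (fun x => j x.1) (res φ u.1)
    (hθ.comp (subtreeEmb_val u.1)) (hφ.comp (subtreeEmb_val u.1)) (hs.comp (subtreeEmb_val u.1))
  have hsum := Finset.sum_le_sum fun u (_ : u ∈ Finset.univ) => (hA' u).1
  rw [weight, weight]
  rcases hsum.lt_or_eq with hlt | heq
  · have h1 := pairCount_le_card_sq fun v : FirstLevel T => φ v.1
    have h2 : Fintype.card (FirstLevel T) ≤ Nat.card T := by
      rw [← Nat.card_eq_fintype_card]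
      exact Finite.card_subtype_le _
    have h3 := (h1.trans (Nat.mul_le_mul h2 h2)).trans_lt hN
    have h4 := Nat.mul_le_mul_left N (Nat.succ_le_of_lt hlt)
    rw [Nat.mul_succ] at h4
    have h5 : pairCount (fun v : FirstLevel T => φ v.1) +
        N * ∑ v : FirstLevel T, weight N (below T v.1) (res φ v.1) <
        pairCount (fun v : FirstLevel T => θ v.1) +
        N * ∑ v : FirstLevel T, weight N (below T v.1) (res θ v.1) := by omega
    exact ⟨h5.le, fun h => absurd h h5.ne⟩
  have hk : ∀ u : FirstLevel T, KerEquiv (res φ u.1) (res θ u.1) := fun u =>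
    (hA' u).2 ((Finset.sum_eq_sum_iff_of_le fun u _ => (hA' u).1).1 heq u (Finset.mem_univ _))
  have hc : ∀ v w : FirstLevel T, φ v.1 = φ w.1 → KerEquiv (res θ v.1) (res θ w.1) :=
    fun v w h => ((hk v).symm.trans
      (hφ.strict _ _ (siblings_firstLevel v w) h).kerEquiv).trans (hk w)
  have hinj : LabelInj (fun v : FirstLevel T => φ v.1) fun v => j v.1 := fun v w h h' =>
    eq_of_swapFree hB hθ hφ hs h
      (hθ.eq_of_label _ _ (siblings_firstLevel v w) (hc v w h) h') (hk v)
  have hle := pairCount_le hinj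
  rw [← hθ.labelInit.pairCount_eq hθ.labelInj] at hle
  rw [heq]
  refine ⟨Nat.add_le_add_right hle _, fun h => ?_⟩
  have hi := labelInit_of_pairCount_eq hinj
    ((Nat.add_right_cancel h).trans (hθ.labelInit.pairCount_eq hθ.labelInj))
  let c : FirstLevel T → Set (FirstLevel T) := fun v => {w | KerEquiv (res θ v.1) (res θ w.1)}
  have hcc : ∀ v w, c v = c w ↔ KerEquiv (res θ v.1) (res θ w.1) := fun v w =>
    ⟨fun h => (show w ∈ c v from h ▸ KerEquiv.refl (res θ w.1)), fun h => Set.ext fun z =>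
      ⟨fun h' => h.symm.trans h', fun h' => h.trans h'⟩⟩
  obtain ⟨σ, hσc, hσ⟩ := exists_perm_of_label (c := c) (fun v w h => (hcc v w).2 (hc v w h)) hinj hi
    (fun v w h => (hcc v w).2 (hθ.regular.strict _ _ (siblings_firstLevel v w) h).kerEquiv)
    hθ.labelInj hθ.labelInit
  exact kerEquiv_of_firstLevel hφ hθ.regular σ hσ fun v =>
    (hk v).trans ((hcc _ _).1 (hσc v)).symm

/-- Here `ψ' = ψ ∘ g`, and the extremal property is applied to the tableau `(φ ∘ g, ψ ∘ g)` and to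
the competitor `φ`. The labels `j` and `j ∘ g` then both number the fibers of `φ` initially, so a
permutation `σ` of the first level matches them; uniqueness in the subtrees supplies the
isomorphisms to be glued along `σ`. -/
theorem transposeUnique_of_firstLevel {N : ℕ} {X Z : Type*} {T : RootedTree.{u}} [Finite T]
    (hA : ∀ u : FirstLevel T, WeightLe N X Z (below T u.1))
    (hB : ∀ u : FirstLevel T, TransposeUnique X Z (below T u.1)) : TransposeUnique X Z T := by
  rintro φ ψ ψ' j ht ⟨g, hg⟩ hs
  obtain rfl : (fun x => ψ (g x)) = ψ' := funext hg
  have hgt := ht.comp (subtreeEmb_orderIso g)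
  have hφ := ht.regular
  have hA' := fun u : FirstLevel T => hA u _ _ _ (res φ u.1)
    (hgt.comp (subtreeEmb_val u.1)) (hφ.comp (subtreeEmb_val u.1)) (hs.comp (subtreeEmb_val u.1))
  have hgu : ∀ u : FirstLevel T, StrictEquiv (res (fun x => φ (g x)) u.1) (res φ (g u.1)) :=
    fun u => (subtreeEmb_orderIso g).strictEquiv φ u.1
  -- Since `g` permutes the first level, the subtree weights of `φ` and of `φ ∘ g` have the same
  -- sum; every inequality in `hA'` is thus an equality.
  have hk : ∀ u : FirstLevel T, KerEquiv (res φ u.1) (res (fun x => φ (g x)) u.1) := by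
    refine fun u => (hA' u).2 ((Finset.sum_eq_sum_iff_of_le fun u _ => (hA' u).1).1 ?_ u
      (Finset.mem_univ _))
    rw [← Equiv.sum_comp (firstLevelEquiv g)]
    refine Finset.sum_congr rfl fun v _ => ?_
    exact (weight_comp N _ (below T v.1) (below T (g v.1)) (Nat.lt_succ_self _)
      ((subtreeEmb_orderIso g).belowIso v.1) (res φ (g v.1))).symm
  have hinj : LabelInj (fun v : FirstLevel T => φ v.1) fun v => j (g v.1) := fun v w h h' =>
    eq_of_swapFree hB hgt hφ hs h (hgt.eq_of_label _ _ (siblings_firstLevel v w)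
      (((hk v).symm.trans (hφ.strict _ _ (siblings_firstLevel v w) h).kerEquiv).trans (hk w)) h')
      (hk v)
  -- Reindexing by `g` does not change `∑ (2j + 1)`, so the bound on the number of pairs is
  -- attained.
  have hi : LabelInit (fun v : FirstLevel T => φ v.1) fun v => j (g v.1) := by
    refine labelInit_of_pairCount_eq hinj ?_
    rw [ht.labelInit.pairCount_eq ht.labelInj, ← Equiv.sum_comp (firstLevelEquiv g)]
    rfl
  obtain ⟨σ, hσ⟩ := exists_perm_of_labelInit ht.labelInj ht.labelInit hinj hi
  have hg1 : ∀ v : FirstLevel T, ⊥ ⋖ g v.1 := fun v => (firstLevelEquiv g v).2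
  have hψ : ∀ v : FirstLevel T, ψ v.1 = ψ (g (σ v).1) := fun v =>
    ht.eq_of_label _ _ ⟨⊥, v.2, hg1 _⟩
      (((hφ.strict _ _ (siblings_firstLevel v (σ v)) (hσ v).1.symm).kerEquiv.trans (hk _)).trans
        (hgu _).kerEquiv) (hσ v).2.symm
  have hτ : ∀ v : FirstLevel T, ∃ τ : below T v.1 ≃o below T (σ v).1,
      (∀ x, φ (τ x).1 = φ x.1) ∧ ∀ x, ψ (g (τ x).1) = ψ x.1 := by
    intro v
    obtain ⟨τ, hτ⟩ := hφ.strict _ _ (siblings_firstLevel v (σ v)) (hσ v).1.symm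
    have h1 : SwapFree (res φ v.1) fun x => ψ (g (τ x).1) := by
      have := (hs.comp (subtreeEmb_val (σ v).1)).comp (subtreeEmb_orderIso τ)
      rwa [show (fun x => φ (τ x).1) = res φ v.1 from funext hτ] at this
    have h2 : StrictEquiv (fun x => ψ (g (τ x).1)) (res ψ v.1) :=
      StrictEquiv.trans ⟨τ.trans ((subtreeEmb_orderIso g).belowIso (σ v).1), fun _ => rfl⟩
        (ht.regular'.strict _ _ ⟨⊥, v.2, hg1 _⟩ (hψ v)).symm
    obtain ⟨h, hh, hh'⟩ := hB v _ _ _ _ (ht.comp (subtreeEmb_val v.1)) h2 h1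
    exact ⟨h.trans τ, fun x => (hτ _).trans (hh x), hh'⟩
  choose τ hτφ hτψ using hτ
  obtain ⟨ε, hε⟩ := exists_glue σ τ
  refine ⟨ε, fun x => ?_, fun x => ?_⟩ <;> by_cases hx : x = ⊥
  · rw [hx, ε.map_bot]
  · obtain ⟨v, hv⟩ := exists_firstLevel_le hx
    exact (congrArg φ (hε v ⟨x, hv⟩)).trans (hτφ v _)
  · change ψ (g (ε x)) = ψ x
    rw [hx, ε.map_bot, g.map_bot]
  · obtain ⟨v, hv⟩ := exists_firstLevel_le hx
    exact (congrArg (fun y => ψ (g y)) (hε v ⟨x, hv⟩)).trans (hτψ v _)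

theorem weightLe_and_transposeUnique (N n : ℕ) (X Z : Type*) : ∀ (T : RootedTree.{u}) [Finite T],
    Nat.card T < n → Nat.card T * Nat.card T < N → WeightLe N X Z T ∧ TransposeUnique X Z T := by
  induction n with
  | zero => exact fun T _ h => absurd h (Nat.not_lt_zero _)
  | succ n ih =>
    intro T _ hn hN
    have key : ∀ u : FirstLevel T,
        WeightLe N X Z (below T u.1) ∧ TransposeUnique X Z (below T u.1) := fun u => by
      have := card_below_lt u.2
      exact ih _ (by omega) ((Nat.mul_le_mul this.le this.le).trans_lt hN)
    exact ⟨weightLe_of_firstLevel hN (fun u => (key u).1) fun u => (key u).2,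
      transposeUnique_of_firstLevel (fun u => (key u).1) fun u => (key u).2⟩

theorem transposeUnique (X Z : Type*) (T : RootedTree.{u}) [Finite T] : TransposeUnique X Z T :=
  (weightLe_and_transposeUnique _ _ X Z T (Nat.lt_succ_self _) (Nat.lt_succ_self _)).2

end Weight

/-! ### Tree compositions are regular -/

theorem eq_of_leaf_of_le {T : RootedTree.{u}} {u x : T} (h : Leaf u) (hx : u ≤ x) : x = u :=
  (hx.eq_or_lt.resolve_right fun hlt => h (internal_of_lt hlt)).symm

theorem exists_leafIso {T : RootedTree.{u}} {u v : T} (hu : Leaf u) (hv : Leaf v) :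
    Nonempty (below T u ≃o below T v) := by
  have hu' : ∀ x : below T u, x = ⊥ := fun x => Subtype.ext (eq_of_leaf_of_le hu x.2)
  have hv' : ∀ x : below T v, x = ⊥ := fun x => Subtype.ext (eq_of_leaf_of_le hv x.2)
  exact ⟨{ toFun := fun _ => ⊥, invFun := fun _ => ⊥
           left_inv := fun x => (hu' x).symm, right_inv := fun x => (hv' x).symm
           map_rel_iff' := fun {a b} => by rw [hu' a, hu' b]; exact iff_of_true le_rfl le_rfl }⟩

theorem strictEquiv_of_leaf {T : RootedTree.{u}} {X : Type*} {φ : T → X} {u v : T} (hu : Leaf u)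
    (hv : Leaf v) (h : φ u = φ v) : StrictEquiv (res φ u) (res φ v) := by
  obtain ⟨τ⟩ := exists_leafIso hu hv
  refine ⟨τ, fun x => ?_⟩
  change φ _ = φ _
  rw [eq_of_leaf_of_le hu x.2, eq_of_leaf_of_le hv (τ x).2]
  exact h.symm

theorem internal_bot_below_iff {T : RootedTree.{u}} (u : T) :
    Internal (⊥ : below T u) ↔ Internal u := by
  constructor
  · rintro ⟨c, hc⟩
    exact ⟨c.1, ((subtreeEmb_val u).covBy_iff _ _).2 hc⟩
  · rintro ⟨c, hc⟩
    exact ⟨⟨c, hc.le⟩, ((subtreeEmb_val u).covBy_iff ⊥ ⟨c, hc.le⟩).1 hc⟩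

theorem internal_iff_of_iso {T T' : RootedTree.{u}} {u : T} {v : T'} (τ : below T u ≃o below T' v) :
    Internal u ↔ Internal v := by
  have h := internal_map_iff τ (x := ⊥)
  rw [τ.map_bot] at h
  exact (internal_bot_below_iff u).symm.trans (h.symm.trans (internal_bot_below_iff v))

namespace TreeComposition

variable {T P Q : RootedTree.{u}}

theorem internal_iff (φ : TreeComposition T P) (u : T) : Internal (φ u) ↔ Internal u :=
  ⟨fun h => by_contra fun h' => φ.map_leaf h' h, fun ⟨c, hc⟩ => ⟨φ c, φ.map_child hc⟩⟩

theorem lt_of_lt (φ : TreeComposition T P) {x y : T} (h : x < y) : φ x < φ y := by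
  obtain ⟨p, hp⟩ := exists_parent h.ne_bot
  exact (φ.monotone (le_parent_of_lt hp h)).trans_lt (φ.map_child hp).lt

theorem siblings_map (φ : TreeComposition T P) {u v : T} (h : Siblings u v) :
    Siblings (φ u) (φ v) := by
  obtain ⟨p, hu, hv⟩ := h
  exact ⟨φ p, φ.map_child hu, φ.map_child hv⟩

theorem isRegular (φ : TreeComposition T P) : Regular φ where
  eq_of_le x y h e := h.eq_or_lt.resolve_right fun hlt => (φ.lt_of_lt hlt).ne e
  parent p q x y hp hq e := parent_unique (φ.map_child hp) (e ▸ φ.map_child hq)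
  strict u v hs e := by
    by_cases huv : u = v
    · subst huv
      exact StrictEquiv.refl _
    by_cases hu : Internal u
    · have hv : Internal v := (φ.internal_iff v).1 (e ▸ (φ.internal_iff u).2 hu)
      obtain ⟨τ, rfl, hτ⟩ := φ.regular huv hs hu hv e
      exact ⟨(subtreeEmb_orderIso τ).belowIso u, fun x => (hτ x.1 x.2).symm⟩
    · have hv : ¬ Internal v := fun hv =>
        hu ((φ.internal_iff u).1 (e ▸ (φ.internal_iff v).2 hv))
      exact strictEquiv_of_leaf hu hv e

theorem exists_le_of_le (φ : TreeComposition T P) {y : P} {z : T} (h : y ≤ φ z) :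
    ∃ x, x ≤ z ∧ φ x = y := by
  induction z using parent_induction with
  | h0 => exact ⟨⊥, le_rfl, by rw [φ.map_root] at h ⊢; exact (le_bot_iff.1 h).symm⟩
  | h p z hp ih =>
    rcases h.eq_or_lt with h | h
    · exact ⟨z, le_rfl, h.symm⟩
    · obtain ⟨x, hx, hx'⟩ := ih (le_parent_of_lt (φ.map_child hp) h)
      exact ⟨x, hx.trans hp.le, hx'⟩

theorem exists_between (φ : TreeComposition T P) {u z : T} (hu : u ≤ z) {y : P} (hy : φ u ≤ y)
    (h : y ≤ φ z) : ∃ x, u ≤ x ∧ x ≤ z ∧ φ x = y := by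
  obtain ⟨x, hx, rfl⟩ := φ.exists_le_of_le h
  rcases le_total_of_directed hu hx with h' | h'
  · rcases h'.eq_or_lt with h' | h'
    · exact ⟨x, h'.ge, hx, rfl⟩
    · exact absurd hy (not_le_of_gt (φ.lt_of_lt h'))
  · exact ⟨x, h', hx, rfl⟩

/-- Regularity concerns siblings only. By induction on the depth, the isomorphism between the
subtrees at the parents carries `w` to a sibling of `u`, where regularity applies. -/
theorem strictEquiv_of_eq (φ : TreeComposition T P) {u w : T} (h : φ w = φ u) :
    StrictEquiv (res φ w) (res φ u) := by
  induction u using parent_induction generalizing w with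
  | h0 =>
    rw [φ.isRegular.eq_of_le ⊥ w bot_le h.symm]
    exact StrictEquiv.refl _
  | h p u hp ih =>
    have hw : w ≠ ⊥ := by
      rintro rfl
      exact hp.lt.ne_bot (φ.isRegular.eq_of_le ⊥ u bot_le h).symm
    obtain ⟨q, hq⟩ := exists_parent hw
    obtain ⟨τ, hτ⟩ := ih (φ.isRegular.parent q p w u hq hp h)
    let a : below T q := ⟨w, hq.le⟩
    have hf : SubtreeEmb fun x => (τ x).1 := (subtreeEmb_val p).comp (subtreeEmb_orderIso τ)
    have h1 := (subtreeEmb_val q).strictEquiv φ a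
    have h2 := hf.strictEquiv φ a
    rw [show (fun x => φ (τ x).1) = fun x => φ x.1 from funext hτ] at h2
    have hpa : p ⋖ (τ a).1 := by
      have := (hf.covBy_iff ⊥ a).2 (((subtreeEmb_val q).covBy_iff ⊥ a).1 hq)
      have hp' : (τ ⊥).1 = p := congrArg Subtype.val τ.map_bot
      rwa [hp'] at this
    exact (h1.symm.trans h2).trans (φ.isRegular.strict _ _ ⟨p, hpa, hp⟩ ((hτ a).trans h))

/-- A preimage of `y` may lie above another vertex of the fiber of `u`; `strictEquiv_of_eq` moves it
above `u`. -/
theorem restrict_surjective (φ : TreeComposition T P) (u : T) :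
    Function.Surjective (φ.restrict u) := by
  intro y
  obtain ⟨z, hz⟩ := φ.surjective y.1
  have hy : φ u ≤ φ z := hz ▸ y.2
  obtain ⟨x, hx, hxu⟩ := φ.exists_le_of_le hy
  obtain ⟨τ, hτ⟩ := φ.strictEquiv_of_eq hxu
  exact ⟨τ ⟨z, hx⟩, Subtype.ext ((hτ ⟨z, hx⟩).trans hz)⟩

/-- `ω` is defined through a section of `φ_u`, and the hypothesis makes it independent of the
section. It is monotone because comparable vertices of `P_{φ(u)}` lift to comparable vertices of
`T_u`. -/
theorem exists_monotone_of_ker (φ : TreeComposition T P) {u v : T} (τ : below T u ≃o below T v)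
    (hτ : ∀ x y, res φ u x = res φ u y → res φ v (τ x) = res φ v (τ y)) :
    ∃ ω : below P (φ u) → below P (φ v), Monotone ω ∧
      ∀ x, ω (φ.restrict u x) = φ.restrict v (τ x) := by
  choose s hs using φ.restrict_surjective u
  have hω : ∀ x, φ.restrict v (τ (s (φ.restrict u x))) = φ.restrict v (τ x) := fun x =>
    Subtype.ext (hτ _ _ (congrArg Subtype.val (hs (φ.restrict u x))))
  refine ⟨fun y => φ.restrict v (τ (s y)), fun y y' hyy => ?_, hω⟩
  have h1 : φ (s y').1 = y'.1 := congrArg Subtype.val (hs y')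
  obtain ⟨x, hux, hx, hxy⟩ := φ.exists_between (s y').2 y.2 (h1 ▸ hyy)
  have h2 : φ.restrict u ⟨x, hux⟩ = y := Subtype.ext hxy
  change φ.restrict v (τ (s y)) ≤ _
  rw [← h2, hω]
  exact φ.monotone (τ.monotone (show (⟨x, hux⟩ : below T u) ≤ s y' from hx))

theorem areEquivalent_of_kerEquiv (φ : TreeComposition T P) {u v : T}
    (h : KerEquiv (res φ u) (res φ v)) : AreEquivalent (φ.restrict u) (φ.restrict v) := by
  obtain ⟨τ, hτ⟩ := h
  obtain ⟨ω, hm, hω⟩ := φ.exists_monotone_of_ker τ fun x y => (hτ x y).1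
  obtain ⟨ω', hm', hω'⟩ := φ.exists_monotone_of_ker τ.symm fun x y h => (hτ _ _).2 (by
    rwa [τ.apply_symm_apply, τ.apply_symm_apply])
  let e : below P (φ u) ≃ below P (φ v) :=
    { toFun := ω, invFun := ω'
      left_inv := fun y => by
        obtain ⟨x, rfl⟩ := φ.restrict_surjective u y
        rw [hω, hω', τ.symm_apply_apply]
      right_inv := fun y => by
        obtain ⟨x, rfl⟩ := φ.restrict_surjective v y
        rw [hω', hω, τ.apply_symm_apply] }
  exact ⟨τ, e.toOrderIso hm hm', hω⟩

end TreeComposition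

/-! ### The tableau of a composition and of its transpose -/

theorem kerEquiv_of_areEquivalent {T P : RootedTree.{u}} {φ : TreeComposition T P} {u v : T}
    (h : AreEquivalent (φ.restrict u) (φ.restrict v)) : KerEquiv (res φ u) (res φ v) := by
  obtain ⟨τ, ω, h⟩ := h
  refine ⟨τ, fun x y => ?_⟩
  have key : ∀ (w : T) (x y : below T w), res φ w x = res φ w y ↔
      φ.restrict w x = φ.restrict w y := fun w x y => ⟨fun h => Subtype.ext h, congrArg Subtype.val⟩
  rw [key, key, ← h, ← h, ω.injective.eq_iff]

/-- Identifies the fibers of `α ∘ φ` among siblings with the classes used in `Tableau`. Internal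
siblings are governed by the conditions on equivalence, leaves by the uniqueness of the leaf among
the children of a vertex of `Q`. -/
theorem IsQuotient.kerEquiv_iff {T P Q : RootedTree.{u}} {φ : TreeComposition T P}
    {α : TreeComposition P Q} (h : IsQuotient φ α) {v w : T} (hs : Siblings v w) :
    KerEquiv (res φ v) (res φ w) ↔ α (φ v) = α (φ w) := by
  have hi : ∀ x, Internal (α (φ x)) ↔ Internal x := fun x =>
    (α.internal_iff _).trans (φ.internal_iff x)
  constructor
  · intro hk
    have hvw : Internal v ↔ Internal w := internal_iff_of_iso hk.choose
    by_cases hv : Internal v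
    · by_contra hne
      exact h.not_equivalent _ _ hne (α.siblings_map (φ.siblings_map hs)) ((hi v).2 hv)
        ((hi w).2 (hvw.1 hv)) v w hs rfl rfl (φ.areEquivalent_of_kerEquiv hk)
    · obtain ⟨p, hpv, hpw⟩ := hs
      have hw : ¬ Internal w := fun hw => hv (hvw.2 hw)
      exact (h.leaves (φ p) (φ v) (α (φ w)) (φ.map_child hpv) (φ.map_leaf hv)
        (α.map_child (φ.map_child hpw)) (α.map_leaf (φ.map_leaf hw))).symm
  · intro he
    have hvw : Internal v ↔ Internal w := by rw [← hi v, he, hi w]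
    by_cases hv : Internal v
    · exact kerEquiv_of_areEquivalent (h.equivalent v w hv (hvw.1 hv) he)
    · obtain ⟨τ⟩ := exists_leafIso hv fun hw => hv (hvw.2 hw)
      refine ⟨τ, fun x y => ?_⟩
      have hxy : x = y := Subtype.ext ((eq_of_leaf_of_le hv x.2).trans
        (eq_of_leaf_of_le hv y.2).symm)
      rw [hxy]
      exact iff_of_true rfl rfl

theorem ZeroOneIntersection.injective {T P M : RootedTree.{u}} {φ : TreeComposition T P}
    {ψ : TreeComposition T M} (h : ZeroOneIntersection φ ψ) (x y : T) (h1 : φ x = φ y)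
    (h2 : ψ x = ψ y) : x = y := by
  induction x using parent_induction generalizing y with
  | h0 => exact φ.isRegular.eq_of_le _ _ bot_le h1
  | h p x hp ih =>
    have hy : y ≠ ⊥ := by
      rintro rfl
      exact hp.lt.ne_bot (φ.isRegular.eq_of_le ⊥ x bot_le h1.symm).symm
    obtain ⟨q, hq⟩ := exists_parent hy
    exact Set.encard_le_one_iff.1 (h p ⟨x, hp⟩ (φ x) (ψ x) (φ.map_child hp) (ψ.map_child hp)) x y
      ⟨rfl, rfl⟩ ⟨h1.symm, h2.symm⟩

section Label

open Classical

attribute [local instance] Fintype.ofFinite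

theorem blockSizes_eq {T P Q : RootedTree.{u}} [Finite T] (φ : TreeComposition T P)
    (α : TreeComposition P Q) {c : T → Q} (hc : ∀ v, α (φ v) = c v) (p : T) (b : Q) :
    ∃ s : Finset P, (∀ v, p ⋖ v → c v = b → φ v ∈ s) ∧ blockSizes φ α p b = s.val.map fun y =>
        (Finset.univ.filter fun v : {v : T // p ⋖ v ∧ c v = b} => φ v.1 = y).card := by
  have : Finite P := Finite.of_surjective φ φ.surjective
  refine ⟨(Set.toFinite {y : P | φ p ⋖ y ∧ α y = b}).toFinset, fun v hv hb => ?_, ?_⟩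
  · simpa using ⟨φ.map_child hv, (hc v).trans hb⟩
  · refine Multiset.map_congr rfl fun y hy => ?_
    have hy' : φ p ⋖ y ∧ α y = b := by simpa using hy
    rw [Set.ncard_eq_toFinset_card']
    refine (Finset.card_bij (fun v _ => v.1) ?_ (fun a _ b _ => Subtype.ext) ?_).symm
    · intro v hv
      simp only [Finset.mem_filter, Finset.mem_univ, true_and] at hv
      simpa using ⟨v.2.1, hv⟩
    · intro v hv
      have hv' : p ⋖ v ∧ φ v = y := by simpa using hv
      exact ⟨⟨v, hv'.1, by rw [← hc, hv'.2, hy'.2]⟩, by simpa using hv'.2, rfl⟩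

/-- Among the children of `p` lying over one `b`, the fibers of `φ` and `ψ` are set partitions of
conjugate types with `0`-`1` intersection, and `exists_label_of_conjugate` numbers the columns. -/
theorem exists_tableau {T P P' : RootedTree.{u}} [Finite T] {φ : TreeComposition T P}
    {ψ : TreeComposition T P'} (h : IsTranspose φ ψ) : ∃ j, Tableau φ ψ j := by
  obtain ⟨⟨Q, α, β, Λ, hα, -, hβα, hΛ, hΛ'⟩, h01⟩ := h
  have hJ : ∀ (p : T) (b : Q), ∃ J : P' → ℕ, α (φ p) ⋖ b →
      (∀ v w, p ⋖ v → α (φ v) = b → p ⋖ w → α (φ w) = b → J (ψ v) = J (ψ w) → ψ v = ψ w) ∧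
      ∀ v k, p ⋖ v → α (φ v) = b → k < J (ψ v) →
        ∃ w, p ⋖ w ∧ α (φ w) = b ∧ φ w = φ v ∧ J (ψ w) = k := by
    intro p b
    by_cases hb : α (φ p) ⋖ b
    swap
    · exact ⟨fun _ => 0, fun h => absurd h hb⟩
    obtain ⟨s, hs, hs'⟩ := blockSizes_eq φ α (fun _ => rfl) p b
    obtain ⟨t, ht, ht'⟩ := blockSizes_eq ψ β hβα p b
    have hconj : diagram (blockSizes ψ β p b) = (diagram (blockSizes φ α p b)).transpose := by
      rw [← hΛ p b hb]
      exact (hΛ' p b (by rwa [hβα])).symm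
    rw [hs', ht'] at hconj
    obtain ⟨J, hJ, hJ'⟩ := exists_label_of_conjugate
      (V := {v : T // p ⋖ v ∧ α (φ v) = b}) (f := fun v => φ v.1) (p := fun v => ψ v.1)
      (fun v => hs v.1 v.2.1 v.2.2) (fun v => ht v.1 v.2.1 v.2.2)
      (fun v w h1 h2 => Subtype.ext (h01.injective _ _ h1 h2)) hconj
    refine ⟨J, fun _ => ⟨fun v w hv hvb hw hwb => hJ ⟨v, hv, hvb⟩ ⟨w, hw, hwb⟩,
      fun v k hv hvb hk => ?_⟩⟩
    obtain ⟨w, hw, hwk⟩ := hJ' ⟨v, hv, hvb⟩ k hk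
    exact ⟨w.1, w.2.1, w.2.2, hw, hwk⟩
  choose J hJinj hJinit using hJ
  have hpar : ∀ {p v : T}, p ⋖ v → Order.pred v = p := fun hv =>
    parent_unique (Order.pred_covBy_of_not_isMin fun h => hv.lt.ne_bot h.eq_bot) hv
  have hψ : ∀ {v w}, ψ v = ψ w → α (φ v) = α (φ w) := fun {v w} e => by
    rw [← hβα, e, hβα]
  have hinj : ∀ v w, Siblings v w → α (φ v) = α (φ w) →
      J (Order.pred v) (α (φ v)) (ψ v) = J (Order.pred w) (α (φ w)) (ψ w) → ψ v = ψ w := by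
    rintro v w ⟨p, hv, hw⟩ e e'
    rw [hpar hv, hpar hw, ← e] at e'
    exact hJinj p _ (α.map_child (φ.map_child hv)) v w hv rfl hw e.symm e'
  -- The labelings chosen for all pairs `(p, b)` are combined: `p` is the parent of `v` and `b` its
  -- image in `Q`. The value at the root plays no role.
  refine ⟨fun v => J (Order.pred v) (α (φ v)) (ψ v), ?_⟩
  exact
  { regular := φ.isRegular
    regular' := ψ.isRegular
    kerEquiv := fun v w hs e => (hα.kerEquiv_iff hs).2 (hψ e)
    label := fun v w ⟨p, hv, hw⟩ e => by rw [hpar hv, hpar hw, hψ e, e]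
    eq_of_label := fun v w hs e => hinj v w hs ((hα.kerEquiv_iff hs).1 e)
    inj := fun v w hs e e' => h01.injective v w e (hinj v w hs (congrArg α e) e')
    init := fun p v k hv hk => by
      rw [hpar hv] at hk
      obtain ⟨w, hw, hb, h1, h2⟩ := hJinit p _ (α.map_child (φ.map_child hv)) v k hv rfl hk
      exact ⟨w, hw, h1, by rw [hpar hw, hb, h2]⟩ }

end Label

/-! ### The double coset of the identity -/

theorem mem_stab_iff {T P : RootedTree.{u}} (φ : TreeComposition T P) (g : T ≃o T) :
    g ∈ stab φ ↔ ∀ x, φ (g x) = φ x := by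
  rw [stab, MulAction.mem_stabilizer_iff, TreeComposition.ext_iff, funext_iff]
  change (∀ x, φ (g⁻¹ x) = φ x) ↔ _
  constructor
  · intro h x
    rw [← h (g x), RelIso.inv_apply_self]
  · intro h x
    rw [← h (g⁻¹ x), RelIso.apply_inv_self]

theorem stab_inf_stab_eq_bot {T P P' : RootedTree.{u}} {φ : TreeComposition T P}
    {ψ : TreeComposition T P'} (h : ZeroOneIntersection φ ψ) (g : T ≃o T) (h1 : g ∈ stab φ)
    (h2 : g ∈ stab ψ) : g = 1 :=
  OrderIso.ext (funext fun x =>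
    h.injective _ _ ((mem_stab_iff φ g).1 h1 x) ((mem_stab_iff ψ g).1 h2 x))

/-- If the sign is trivial on `K_φ ∩ g K_ψ g⁻¹`, then `g ∈ K_φ K_ψ`. -/
theorem exists_mul_of_treeSign {T P P' : RootedTree.{u}} [Finite T] {φ : TreeComposition T P}
    {ψ : TreeComposition T P'} (h : IsTranspose φ ψ) (g : T ≃o T)
    (hg : ∀ a ∈ stab φ, g⁻¹ * a * g ∈ stab ψ → treeSign T a = 1) :
    ∃ a ∈ stab φ, ∃ b ∈ stab ψ, g = a * b := by
  obtain ⟨j, hj⟩ := exists_tableau h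
  have hs : SwapFree φ fun x => ψ (g⁻¹ x) := swapFree_of_treeSign fun a h1 h2 => by
    refine hg a ((mem_stab_iff _ _).2 h1) ((mem_stab_iff _ _).2 fun x => ?_)
    have := h2 (g x)
    rw [RelIso.inv_apply_self] at this
    exact this
  -- The automorphism `a` satisfies `φ ∘ a = φ` and `ψ ∘ g⁻¹ ∘ a = ψ`, so `g⁻¹a` stabilizes `ψ`.
  obtain ⟨a, h1, h2⟩ := transposeUnique P P' T φ ψ _ j hj ⟨g⁻¹, fun _ => rfl⟩ hs
  refine ⟨a, (mem_stab_iff _ _).2 h1, a⁻¹ * g, ?_, by group⟩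
  rw [← inv_mem_iff, mem_stab_iff]
  intro x
  rw [mul_inv_rev, inv_inv]
  exact h2 x

/-! ### Representations with a one-dimensional space of intertwining maps -/

open Representation

section Semisimple

variable {G V W U : Type*} [Group G] [AddCommGroup V] [Module ℂ V] [AddCommGroup W] [Module ℂ W]
  [AddCommGroup U] [Module ℂ U] {ρ : Representation ℂ G V} {σ : Representation ℂ G W}
  {τ : Representation ℂ G U}

theorem IntertwiningMap.exists_leftInverse [Finite G] (f : σ.IntertwiningMap ρ)
    (hf : Function.Injective f) : ∃ g : ρ.IntertwiningMap σ, ∀ x, g (f x) = x := by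
  have : NeZero (Nat.card G : ℂ) := ⟨Nat.cast_ne_zero.2 Nat.card_pos.ne'⟩
  obtain ⟨g, hg⟩ := MonoidAlgebra.exists_leftInverse_of_injective
    (IntertwiningMap.equivLinearMapAsModule σ ρ f) (LinearMap.ker_eq_bot.2 hf)
  exact ⟨(IntertwiningMap.equivLinearMapAsModule ρ σ).symm g, fun x => LinearMap.congr_fun hg x⟩

theorem IntertwiningMap.exists_rightInverse [Finite G] (f : ρ.IntertwiningMap σ)
    (hf : Function.Surjective f) : ∃ g : σ.IntertwiningMap ρ, ∀ x, f (g x) = x := by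
  have : NeZero (Nat.card G : ℂ) := ⟨Nat.cast_ne_zero.2 Nat.card_pos.ne'⟩
  obtain ⟨g, hg⟩ := IsSemisimpleModule.lifting_property
    (IntertwiningMap.equivLinearMapAsModule ρ σ f) hf LinearMap.id
  exact ⟨(IntertwiningMap.equivLinearMapAsModule σ ρ).symm g, fun x => LinearMap.congr_fun hg x⟩

theorem isIrreducible_toRepresentation {S : Subrepresentation ρ} (hS : IsAtom S) :
    S.toRepresentation.IsIrreducible := by
  have hmap : ∀ R : Subrepresentation S.toRepresentation, ∃ R' : Subrepresentation ρ, R' ≤ S ∧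
      ∀ x : S.toSubmodule, x.1 ∈ R' ↔ x ∈ R := by
    intro R
    refine ⟨⟨R.toSubmodule.map S.toSubmodule.subtype, ?_⟩, ?_, ?_⟩
    · rintro g _ ⟨x, hx, rfl⟩
      exact ⟨_, R.apply_mem_toSubmodule g hx, rfl⟩
    · rintro _ ⟨x, hx, rfl⟩
      exact x.2
    · intro x
      refine ⟨?_, fun h => ⟨x, h, rfl⟩⟩
      rintro ⟨y, hy, h⟩
      rwa [← Subtype.ext h]
  refine { exists_pair_ne := ⟨⊥, ⊤, fun h => hS.1 ?_⟩, eq_bot_or_eq_top := fun R => ?_ }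
  · refine le_bot_iff.1 fun x hx => ?_
    have : (⟨x, hx⟩ : S.toSubmodule) ∈ (⊥ : Subrepresentation S.toRepresentation) := by
      rw [h]; trivial
    have h0 : (⟨x, hx⟩ : S.toSubmodule) = 0 := this
    have h1 : x = 0 := congrArg Subtype.val h0
    rw [h1]
    exact Submodule.zero_mem _
  · obtain ⟨R', hR, h⟩ := hmap R
    rcases hS.le_iff.1 hR with rfl | rfl
    · left
      refine le_bot_iff.1 fun x hx => ?_
      have h0 : x.1 = 0 := (h x).2 hx
      exact Subtype.ext h0
    · right
      exact top_le_iff.1 fun x _ => (h x).1 x.2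

theorem exists_isAtom_le [Finite G] {R : Subrepresentation ρ} (hR : R ≠ ⊥) :
    ∃ S : Subrepresentation ρ, IsAtom S ∧ S ≤ R := by
  have : NeZero (Nat.card G : ℂ) := ⟨Nat.cast_ne_zero.2 Nat.card_pos.ne'⟩
  let e := Subrepresentation.subrepresentationSubmoduleOrderIso (ρ := ρ)
  have : IsAtomic (Subrepresentation ρ) := (OrderIso.isAtomic_iff e).2 inferInstance
  exact (eq_bot_or_exists_atom_le R).resolve_left hR

theorem nontrivial_of_isIrreducible (hσ : σ.IsIrreducible) : ∃ x : W, x ≠ 0 := by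
  by_contra! h
  obtain ⟨a, b, hab⟩ := hσ.exists_pair_ne
  refine hab (SetLike.ext fun x => ?_)
  rw [h x]
  exact iff_of_true (Submodule.zero_mem _) (Submodule.zero_mem _)

/-- Every intertwining map `ρ → τ` is a multiple of the one factoring through `σ`. -/
theorem exists_smul_eq [Finite G] (h1 : Module.finrank ℂ (ρ.IntertwiningMap τ) = 1)
    (hσ : σ.IsIrreducible) {i : σ.IntertwiningMap τ} (hi : Function.Injective i)
    {p : ρ.IntertwiningMap σ} (hp : Function.Surjective p) (f : ρ.IntertwiningMap τ) :
    ∃ c : ℂ, ∀ x, f x = c • i (p x) := by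
  have h0 : i.comp p ≠ 0 := by
    intro h
    obtain ⟨y, hy⟩ := nontrivial_of_isIrreducible hσ
    obtain ⟨x, rfl⟩ := hp y
    refine hy (hi ?_)
    rw [map_zero]
    exact DFunLike.congr_fun h x
  obtain ⟨c, hc⟩ := (finrank_eq_one_iff_of_nonzero' _ h0).1 h1 f
  exact ⟨c, fun x => (DFunLike.congr_fun hc x).symm⟩

theorem finrank_eq_one_of_forall (hσ : σ.IsIrreducible) {s : σ.IntertwiningMap ρ}
    (hs : Function.Injective s) (h : ∀ s' : σ.IntertwiningMap ρ, ∃ c : ℂ, ∀ x, s' x = c • s x) :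
    Module.finrank ℂ (σ.IntertwiningMap ρ) = 1 := by
  have h0 : s ≠ 0 := by
    rintro rfl
    obtain ⟨y, hy⟩ := nontrivial_of_isIrreducible hσ
    exact hy (hs rfl)
  refine (finrank_eq_one_iff_of_nonzero' s h0).2 fun s' => ?_
  obtain ⟨c, hc⟩ := h s'
  exact ⟨c, DFunLike.ext _ _ fun x => (hc x).symm⟩

/-- Composition with a projection `ρ → σ` embeds `Hom(σ, τ)` into the line `Hom(ρ, τ)`. -/
theorem finrank_right_eq_one [Finite G] (h1 : Module.finrank ℂ (ρ.IntertwiningMap τ) = 1)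
    (hσ : σ.IsIrreducible) {s : σ.IntertwiningMap ρ} (hs : Function.Injective s)
    {i : σ.IntertwiningMap τ} (hi : Function.Injective i) :
    Module.finrank ℂ (σ.IntertwiningMap τ) = 1 := by
  obtain ⟨p, hp⟩ := IntertwiningMap.exists_leftInverse s hs
  refine finrank_eq_one_of_forall hσ hi fun i' => ?_
  obtain ⟨c, hc⟩ := exists_smul_eq h1 hσ hi (p := p) (fun x => ⟨_, hp x⟩) (i'.comp p)
  refine ⟨c, fun x => ?_⟩
  have := hc (s x)
  rwa [IntertwiningMap.comp_apply, hp] at this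

/-- Subtracting from `s'` the multiple of `s` given by Schur's lemma leaves a map killed by `p`. If
it were injective, its left inverse followed by `i` would be a map `ρ → τ` not proportional to `i ∘
p`. -/
theorem finrank_left_eq_one [Finite G] [FiniteDimensional ℂ V]
    (h1 : Module.finrank ℂ (ρ.IntertwiningMap τ) = 1)
    (hσ : σ.IsIrreducible) {s : σ.IntertwiningMap ρ} (hs : Function.Injective s)
    {i : σ.IntertwiningMap τ} (hi : Function.Injective i) :
    Module.finrank ℂ (σ.IntertwiningMap ρ) = 1 := by
  have : FiniteDimensional ℂ W := FiniteDimensional.of_injective s.toLinearMap hs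
  obtain ⟨p, hp⟩ := IntertwiningMap.exists_leftInverse s hs
  refine finrank_eq_one_of_forall hσ hs fun s' => ?_
  obtain ⟨c, hc⟩ := (IsIrreducible.algebraMap_intertwiningMap_bijective_of_isAlgClosed
    (ρ := σ)).2 (p.comp s')
  have hc' : ∀ x, p (s' x) = c • x := fun x => (DFunLike.congr_fun hc x).symm
  refine ⟨c, fun x => ?_⟩
  rcases IsIrreducible.injective_or_eq_zero (s' - c • s) with h | h
  · exfalso
    obtain ⟨q, hq⟩ := IntertwiningMap.exists_leftInverse _ h
    obtain ⟨d, hd⟩ := exists_smul_eq h1 hσ hi (p := p) (fun x => ⟨_, hp x⟩) (i.comp q)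
    obtain ⟨y, hy⟩ := nontrivial_of_isIrreducible hσ
    have h2 := hd ((s' - c • s) y)
    have h3 : p ((s' - c • s) y) = 0 := by
      change p (s' y - c • s y) = 0
      rw [map_sub, map_smul, hc', hp, sub_self]
    rw [IntertwiningMap.comp_apply, hq, h3, map_zero, smul_zero] at h2
    exact hy (hi (h2.trans (map_zero i).symm))
  · exact sub_eq_zero.1 (DFunLike.congr_fun h x)

/-- The maps `i ∘ p` and `i' ∘ p'` span the same line, so `p` cannot vanish on the copy of `σ'` in
`ρ`; Schur's lemma concludes. -/
theorem nonempty_equiv [Finite G] (h1 : Module.finrank ℂ (ρ.IntertwiningMap τ) = 1)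
    (hσ : σ.IsIrreducible) {s : σ.IntertwiningMap ρ} (hs : Function.Injective s)
    {i : σ.IntertwiningMap τ} (hi : Function.Injective i) {W' : Type*} [AddCommGroup W']
    [Module ℂ W'] {σ' : Representation ℂ G W'} (hσ' : σ'.IsIrreducible)
    {s' : σ'.IntertwiningMap ρ} (hs' : Function.Injective s')
    {i' : σ'.IntertwiningMap τ} (hi' : Function.Injective i') : Nonempty (σ'.Equiv σ) := by
  obtain ⟨p, hp⟩ := IntertwiningMap.exists_leftInverse s hs
  obtain ⟨p', hp'⟩ := IntertwiningMap.exists_leftInverse s' hs'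
  obtain ⟨c, hc⟩ := exists_smul_eq h1 hσ hi (p := p) (fun x => ⟨_, hp x⟩) (i'.comp p')
  rcases IsIrreducible.bijective_or_eq_zero (p.comp s') with h | h
  · exact ⟨IntertwiningMap.ofBijective _ h⟩
  · exfalso
    obtain ⟨y, hy⟩ := nontrivial_of_isIrreducible hσ'
    have h2 := hc (s' y)
    have h3 : p (s' y) = 0 := DFunLike.congr_fun h y
    rw [IntertwiningMap.comp_apply, hp', h3, map_zero, smul_zero] at h2
    exact hy (hi' (h2.trans (map_zero i').symm))

theorem exists_common_constituent {V W : Type u} [AddCommGroup V] [Module ℂ V]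
    [FiniteDimensional ℂ V] [AddCommGroup W] [Module ℂ W] [Finite G] (ρ : Representation ℂ G V)
    (τ : Representation ℂ G W) (h1 : Module.finrank ℂ (ρ.IntertwiningMap τ) = 1) :
    ∃ (S : Type u) (_ : AddCommGroup S) (_ : Module ℂ S) (σ : Representation ℂ G S),
      σ.IsIrreducible ∧ IsConstituent σ ρ ∧ IsConstituent σ τ ∧
      constituentMultiplicity σ ρ = 1 ∧ constituentMultiplicity σ τ = 1 ∧
      ∀ (S' : Type v) [AddCommGroup S'] [Module ℂ S'] (σ' : Representation ℂ G S'),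
        σ'.IsIrreducible → IsConstituent σ' ρ → IsConstituent σ' τ → Nonempty (σ'.Equiv σ) := by
  obtain ⟨f, hf, -⟩ := finrank_eq_one_iff'.1 h1
  -- A simple subrepresentation `S` of the image of `f` is contained in `τ` and is a quotient of
  -- `ρ`; by semisimplicity it also embeds in `ρ`.
  have hR : f.range ≠ ⊥ := by
    intro h
    refine hf (DFunLike.ext _ _ fun x => ?_)
    have : f x ∈ f.range := (IntertwiningMap.mem_range _ _ f _).2 ⟨x, rfl⟩
    rw [h] at this
    exact this
  obtain ⟨S, hS, hSR⟩ := exists_isAtom_le hR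
  have hσ := isIrreducible_toRepresentation hS
  let i : S.toRepresentation.IntertwiningMap τ := ⟨S.toSubmodule.subtype, fun g => rfl⟩
  have hi : Function.Injective i := Subtype.val_injective
  obtain ⟨q, hq⟩ := IntertwiningMap.exists_leftInverse i hi
  have hsurj : Function.Surjective (q.comp f) := by
    intro y
    obtain ⟨x, hx⟩ := (IntertwiningMap.mem_range _ _ f _).1 (hSR y.2)
    exact ⟨x, by rw [IntertwiningMap.comp_apply, hx]; exact hq y⟩
  obtain ⟨s, hs⟩ := IntertwiningMap.exists_rightInverse _ hsurj
  have hsi : Function.Injective s := Function.LeftInverse.injective hs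
  exact ⟨S.toSubmodule, inferInstance, inferInstance, S.toRepresentation, hσ, ⟨s, hsi⟩, ⟨i, hi⟩,
    finrank_left_eq_one h1 hσ hsi hi, finrank_right_eq_one h1 hσ hsi hi,
    fun S' _ _ σ' hσ' ⟨s', hs'⟩ ⟨i', hi'⟩ => nonempty_equiv h1 hσ hsi hi hσ' hs' hi'⟩

end Semisimple

/-! ### Intertwining maps between induced representations -/

section Induced

/-- Linear maps out of the induced representation amount to functions on `G` compatible with the
character of `K`. -/
theorem exists_indV_lift {G K W : Type*} [Group G] [Group K] [AddCommGroup W] [Module ℂ W]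
    (ι : K →* G) (ρ : Representation ℂ K ℂ) (F : G → W)
    (hF : ∀ k g, (ρ k 1) • F (ι k * g) = F g) :
    ∃ L : IndV ι ρ →ₗ[ℂ] W, ∀ g, L (IndV.mk ι ρ g 1) = F g := by
  let B : MonoidAlgebra ℂ G →ₗ[ℂ] ℂ →ₗ[ℂ] W :=
    (Finsupp.lift _ ℂ G fun g => LinearMap.toSpanSingleton ℂ W (F g)) ∘ₗ
      (MonoidAlgebra.coeffLinearEquiv ℂ).toLinearMap
  have hB : ∀ g a, B (MonoidAlgebra.single g 1) a = a • F g := fun g a => by simp [B]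
  refine ⟨Coinvariants.lift _ (TensorProduct.lift B) fun k => ?_, fun g => ?_⟩
  · refine TensorProduct.ext (MonoidAlgebra.lhom_ext' fun g => LinearMap.ext_ring
      (LinearMap.ext_ring ?_))
    simpa [hB] using hF k g
  · simp [hB]

variable {G : Type u} [Group G]

theorem indV_mk_mul {K W : Type*} [Group K] [AddCommGroup W] [Module ℂ W] (ι : K →* G)
    (ρ : Representation ℂ K W) (k : K) (g : G) (a : W) :
    IndV.mk ι ρ (ι k * g) (ρ k a) = IndV.mk ι ρ g a := by
  have := Coinvariants.mk_self_apply (Representation.tprod ((leftRegular ℂ G).comp ι) ρ) k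
    (TensorProduct.tmul ℂ (MonoidAlgebra.single g (1 : ℂ)) a)
  simpa using this

theorem charRep_apply {K : Type u} [Group K] (χ : K →* ℤˣ) (k : K) (a : ℂ) :
    charRep χ k a = ((χ k : ℤ) : ℂ) * a := rfl

theorem indV_induction {K : Type*} [Group K] (ι : K →* G) (ρ : Representation ℂ K ℂ)
    {M : Submodule ℂ (IndV ι ρ)} (h : ∀ g, IndV.mk ι ρ g 1 ∈ M) (x : IndV ι ρ) : x ∈ M := by
  have : M.mkQ = 0 := IndV.hom_ext _ _ fun g => LinearMap.ext_ring (by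
    simpa using h g)
  exact (Submodule.Quotient.mk_eq_zero M).1 (LinearMap.congr_fun this x)

variable (H K : Subgroup G) (χ : G →* ℤˣ)

/-- The representation induced by a character with values `±1`. -/
abbrev signInd := Representation.ind K.subtype (charRep (χ.comp K.subtype))

/-- The representation induced by the trivial representation. -/
abbrev trivialInd := Representation.ind H.subtype (Representation.trivial ℂ H ℂ)

/-- The canonical basis element of the induced representation attached to a coset. -/
abbrev signInd.single (g : G) : IndV K.subtype (charRep (χ.comp K.subtype)) :=
  IndV.mk K.subtype (charRep (χ.comp K.subtype)) g 1

theorem signInd.single_mul {k : G} (hk : k ∈ K) (g : G) :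
    ((χ k : ℤ) : ℂ) • signInd.single K χ (k * g) = signInd.single K χ g := by
  have := indV_mk_mul K.subtype (charRep (χ.comp K.subtype)) ⟨k, hk⟩ g 1
  rw [charRep_apply] at this
  refine Eq.trans ?_ this
  rw [← map_smul]
  rfl

/-- The sum of the translates by `H` of a canonical basis element. -/
def signInd.orbitSum [Fintype H] (g : G) : IndV K.subtype (charRep (χ.comp K.subtype)) :=
  ∑ h : H, signInd.single K χ (g * (h : G)⁻¹)

theorem signInd.orbitSum_mul [Fintype H] {k : G} (hk : k ∈ K) (g : G) :
    ((χ k : ℤ) : ℂ) • signInd.orbitSum H K χ (k * g) = signInd.orbitSum H K χ g := by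
  unfold signInd.orbitSum
  rw [Finset.smul_sum]
  refine Finset.sum_congr rfl fun h _ => ?_
  rw [mul_assoc, signInd.single_mul K χ hk]

theorem signInd.orbitSum_mul_right [Fintype H] {a : G} (ha : a ∈ H) (g : G) :
    signInd.orbitSum H K χ (g * a) = signInd.orbitSum H K χ g := by
  unfold signInd.orbitSum
  rw [← Equiv.sum_comp (Equiv.mulRight (⟨a, ha⟩ : H))]
  refine Finset.sum_congr rfl fun h _ => ?_
  simp [mul_assoc]

theorem signInd.ind_orbitSum [Fintype H] {a : G} (ha : a ∈ H) :
    signInd K χ a (signInd.orbitSum H K χ 1) = signInd.orbitSum H K χ 1 := by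
  unfold signInd.orbitSum
  rw [map_sum, ← Equiv.sum_comp (Equiv.mulLeft (⟨a, ha⟩ : H)⁻¹)]
  refine Finset.sum_congr rfl fun h _ => ?_
  rw [ind_mk]
  congr 1
  simp [mul_assoc]

/-- The sum of the translates by `H` is a multiple of the one attached to the trivial coset. -/
theorem signInd.orbitSum_mem_span [Fintype H]
    (hdc : ∀ g : G, (∀ a ∈ H, g⁻¹ * a * g ∈ K → χ a = 1) → ∃ a ∈ H, ∃ b ∈ K, g = a * b) (g : G) :
    signInd.orbitSum H K χ g ∈ Submodule.span ℂ {signInd.orbitSum H K χ 1} := by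
  -- The induced representation is built from cosets `Kg` with `H` acting on the right, so `hdc` is
  -- applied to `g⁻¹`. In the second case an element of `H` fixing the coset with sign `-1` makes
  -- the orbit sum equal to its own opposite.
  by_cases hg : ∀ a ∈ H, g * a * g⁻¹ ∈ K → χ a = 1
  · obtain ⟨a, ha, b, hb, h⟩ := hdc g⁻¹ (by simpa using hg)
    have hg' : g = b⁻¹ * a⁻¹ := by rw [← inv_inv g, h, mul_inv_rev]
    rw [hg', signInd.orbitSum_mul_right H K χ (inv_mem ha)]
    have h1 := signInd.orbitSum_mul H K χ hb b⁻¹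
    rw [mul_inv_cancel] at h1
    rw [← h1]
    exact Submodule.smul_mem _ _ (Submodule.mem_span_singleton_self _)
  · push Not at hg
    obtain ⟨a, ha, hk, hχ⟩ := hg
    have h1 := signInd.orbitSum_mul H K χ hk g
    rw [inv_mul_cancel_right, signInd.orbitSum_mul_right H K χ ha] at h1
    have h2 : χ (g * a * g⁻¹) = -1 := by
      rw [map_mul, map_mul, map_inv, mul_comm, inv_mul_cancel_left]
      exact (Int.units_eq_one_or _).resolve_left hχ
    rw [h2] at h1
    have h3 : signInd.orbitSum H K χ g = 0 := by
      rw [Units.val_neg, Units.val_one, Int.cast_neg, Int.cast_one, neg_smul, one_smul] at h1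
      have h4 : (2 : ℂ) • signInd.orbitSum H K χ g = 0 := by
        rw [two_smul]
        nth_rewrite 1 [← h1]
        exact neg_add_cancel _
      exact (smul_eq_zero.1 h4).resolve_left two_ne_zero
    rw [h3]
    exact Submodule.zero_mem _

/-- The linear form reading the coefficient at the coset `K` takes the value `1` on the sum, since
only the identity of `H` lies in `K`. -/
theorem signInd.orbitSum_one_ne_zero [Fintype H] (hHK : ∀ g ∈ H, g ∈ K → g = 1) :
    signInd.orbitSum H K χ 1 ≠ 0 := by
  classical
  obtain ⟨L, hL⟩ := exists_indV_lift K.subtype (charRep (χ.comp K.subtype))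
    (fun g => if g ∈ K then ((χ g : ℤ) : ℂ) else 0) (by
      intro k g
      have hk : K.subtype k * g ∈ K ↔ g ∈ K := Subgroup.mul_mem_cancel_left K k.2
      rw [charRep_apply, if_congr hk rfl rfl]
      split_ifs with hg
      · rcases Int.units_eq_one_or (χ k.1) with h | h <;> simp [h]
      · simp)
  intro h
  have h1 := congrArg L h
  unfold signInd.orbitSum at h1
  rw [map_sum, map_zero, Fintype.sum_eq_single 1] at h1
  · rw [hL] at h1
    simp at h1
  · intro x hx
    rw [hL, if_neg]
    intro hx'
    rw [one_mul, inv_mem_iff] at hx'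
    exact hx (Subtype.ext (hHK _ x.2 hx'))

/-- By Frobenius reciprocity, a map is determined by the `H`-invariant image of the generator `a₀`.
Invariant vectors are averages over `H`, hence combinations of orbit sums, and these all lie on the
line of the one attached to the identity coset. -/
theorem finrank_intertwiningMap_ind [Finite G] (hHK : ∀ g ∈ H, g ∈ K → g = 1)
    (hdc : ∀ g : G, (∀ a ∈ H, g⁻¹ * a * g ∈ K → χ a = 1) → ∃ a ∈ H, ∃ b ∈ K, g = a * b) :
    Module.finrank ℂ ((trivialInd H).IntertwiningMap (signInd K χ)) = 1 := by
  have : Fintype H := Fintype.ofFinite H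
  let a₀ : IndV H.subtype (Representation.trivial ℂ H ℂ) := IndV.mk H.subtype _ 1 1
  have hmk : ∀ g, IndV.mk H.subtype (Representation.trivial ℂ H ℂ) g 1 = trivialInd H g⁻¹ a₀ := by
    intro g
    rw [ind_mk, one_mul, inv_inv]
  have ha₀ : ∀ h : H, trivialInd H h a₀ = a₀ := by
    intro h
    rw [← inv_inv (h : G), ← hmk]
    have := indV_mk_mul H.subtype (Representation.trivial ℂ H ℂ) h⁻¹ 1 1
    rw [mul_one] at this
    exact this
  obtain ⟨L, hL⟩ := exists_indV_lift H.subtype (Representation.trivial ℂ H ℂ)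
    (fun g => signInd K χ g⁻¹ (signInd.orbitSum H K χ 1)) (by
      intro h g
      rw [Representation.trivial_apply, one_smul, mul_inv_rev, map_mul, Module.End.mul_apply]
      congr 1
      exact signInd.ind_orbitSum H K χ (inv_mem h.2))
  let f₀ : (trivialInd H).IntertwiningMap (signInd K χ) := ⟨L, fun g => by
    refine IndV.hom_ext _ _ fun x => LinearMap.ext_ring ?_
    change L (trivialInd H g (IndV.mk _ _ x 1)) = signInd K χ g (L (IndV.mk _ _ x 1))
    rw [ind_mk, hL, hL, mul_inv_rev, inv_inv, map_mul, Module.End.mul_apply]⟩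
  have hf₀ : f₀ a₀ = signInd.orbitSum H K χ 1 := by
    refine (hL 1).trans ?_
    rw [inv_one, map_one, Module.End.one_apply]
  have hf₀' : f₀ ≠ 0 := by
    intro h
    refine signInd.orbitSum_one_ne_zero H K χ hHK ?_
    rw [← hf₀, h]
    rfl
  refine (finrank_eq_one_iff_of_nonzero' f₀ hf₀').2 fun f => ?_
  have havg : ∀ b : IndV K.subtype (charRep (χ.comp K.subtype)),
      ∑ h : H, signInd K χ h b ∈ Submodule.span ℂ {signInd.orbitSum H K χ 1} := by
    intro b
    let M := (Submodule.span ℂ {signInd.orbitSum H K χ 1}).comap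
      (∑ h : H, signInd K χ (h : G))
    have hb : b ∈ M := indV_induction _ _ (fun g => by
      rw [Submodule.mem_comap, LinearMap.sum_apply]
      simp only [ind_mk]
      exact signInd.orbitSum_mem_span H K χ hdc g) b
    rwa [Submodule.mem_comap, LinearMap.sum_apply] at hb
  have hfa : ∀ h : H, signInd K χ h (f a₀) = f a₀ := fun h => by
    rw [← IntertwiningMap.isIntertwining, ha₀]
  have h1 := havg (f a₀)
  simp only [hfa, Finset.sum_const, Finset.card_univ] at h1
  -- Summing the invariant vector `f a₀` over `H` multiplies it by `|H|`, which is invertible in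
  -- `ℂ`.
  rw [← Nat.cast_smul_eq_nsmul ℂ, Submodule.smul_mem_iff _ (Nat.cast_ne_zero.2 Fintype.card_ne_zero),
    Submodule.mem_span_singleton] at h1
  obtain ⟨c, hc⟩ := h1
  refine ⟨c, IntertwiningMap.ext (IndV.hom_ext _ _ fun g => LinearMap.ext_ring ?_)⟩
  change c • f₀ (IndV.mk _ _ g 1) = f (IndV.mk _ _ g 1)
  rw [hmk, IntertwiningMap.isIntertwining, IntertwiningMap.isIntertwining, hf₀, ← hc, map_smul]

end Induced

end TreeRep

end

/-! ### The common constituent of the two induced representations -/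

theorem mainTheorem12 {T P P' : RootedTree.{u}} [Finite T]
    (φ : TreeRep.TreeComposition T P) (φt : TreeRep.TreeComposition T P')
    (hφt : TreeRep.IsTranspose φ φt) :
    ∃ (S : Type u) (_ : AddCommGroup S) (_ : Module ℂ S) (σ : Representation ℂ (T ≃o T) S),
      σ.IsIrreducible ∧
      TreeRep.IsConstituent σ (TreeRep.youngModule φ) ∧
      TreeRep.IsConstituent σ (TreeRep.signedYoungModule φt) ∧
      TreeRep.constituentMultiplicity σ (TreeRep.youngModule φ) = 1 ∧
      TreeRep.constituentMultiplicity σ (TreeRep.signedYoungModule φt) = 1 ∧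
      ∀ (S' : Type v) [AddCommGroup S'] [Module ℂ S'] (σ' : Representation ℂ (T ≃o T) S'),
        σ'.IsIrreducible →
        TreeRep.IsConstituent σ' (TreeRep.youngModule φ) →
        TreeRep.IsConstituent σ' (TreeRep.signedYoungModule φt) →
        Nonempty (σ'.Equiv σ) := by
  have : Finite (T ≃o T) := Finite.of_injective (fun g : T ≃o T => (g : T → T)) DFunLike.coe_injective
  exact TreeRep.exists_common_constituent _ _ (TreeRep.finrank_intertwiningMap_ind
    (TreeRep.stab φ) (TreeRep.stab φt) (TreeRep.treeSign T)
    (TreeRep.stab_inf_stab_eq_bot hφt.2) (TreeRep.exists_mul_of_treeSign hφt))
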